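/- Let $\mathbb{F}_q$ be the finite field with $q$ elements, let $n \ge 5$ be an integer and let $S \subset \mathbb{F}_q^n$. Let $\tau > 0$ and $\delta \in (0,1)$ be real numbers such that $$q \ge 32\max\left(\frac{n(1+\tau)}{(\tau\delta)^2},\, n\right).$$ Suppose that $q^r < |S| \le q^{r+1}$ for some integer $r$ with $4 \le r \le n-1$, and let $t = r-3$. Let $U_S$ denote a random variable uniformly distributed on $S$. Then for at least a $(1-\delta)$-fraction of all surjective $\mathbb{F}_q$-linear maps $L : \mathbb{F}_q^n \to \mathbb{F}_q^t$, the distribution of $L(U_S)$ is $\tau/q^t$-close to the uniform distribution on $\mathbb{F}_q^t$ in the $\ell_\infty$ norm, that is, $$\left|\Pr[L(U_S) = y] - q^{-t}\right| \le \tau q^{-t} \quad \text{for every } y \in \mathbb{F}_q^t.$$ -/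

import Mathlib

/-- Closeness in the `ℓ_∞` norm of two probability distributions on `α`: all point
probabilities differ by at most `ε`. -/
def IsLInftyClose {α : Type*} (P Q : PMF α) (ε : ℝ) : Prop :=
  ∀ a : α, |(P a).toReal - (Q a).toReal| ≤ ε

/-- The fraction of the elements of the (finite, nonempty) set `A` that lie in `B`. -/
noncomputable def fractionIn {α : Type*} (A B : Set α) : ℝ :=
  ((A ∩ B).ncard : ℝ) / (A.ncard : ℝ)

/-- The set of surjective `F`-linear maps `F^n → F^t`. -/
def surjLinearMaps (F : Type*) [Field F] (n t : ℕ) :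
    Set ((Fin n → F) →ₗ[F] (Fin t → F)) :=
  {L | Function.Surjective L}

/-- The distribution of `L(U_S)`, where `U_S` is uniformly distributed on the nonempty
finite set `S`. -/
noncomputable def hashDistribution {F : Type*} [Field F] {n t : ℕ}
    (L : (Fin n → F) →ₗ[F] (Fin t → F)) (S : Finset (Fin n → F)) (hS : S.Nonempty) :
    PMF (Fin t → F) :=
  (PMF.uniformOfFinset S hS).map L

/-! Argue by contradiction, assuming that more than a proportion δ of the surjections are
unbalanced. Put m = t + 2, fix a surjection `N` onto F^m, and write a surjection L onto F^t as M ∘ N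
∘ g, with g an automorphism of F^n and ker M a plane. Let μ = |S|/q^m, which exceeds q, and let E_g
be the set of points of F^m over which the fiber of N ∘ g in S has size off from μ by at least τμ/2.

Automorphisms act transitively on surjections, and those preserving L act transitively on the
nonzero vectors of ker L. Hence a random g behaves almost pairwise independently even when M ∘ N ∘ g
= L is prescribed, and second moments are available (`LinearMap.sum_transporter_sq_le`). They show
two things. E_g has density at most a = δ/(2n) for all but a proportion δ/4 of the g. If L is
unbalanced at y, then for at least half of the g over L the set E_g contains all but a fraction
1/(4n) of the plane M = y. So every plane direction is nearly contained, up to translation, in a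
sparse E_g for a proportion δ/4 of the g (`card_small_deviationSet_ge`). Greedily, ⌈4/δ⌉
automorphisms serve more than half of all pairs of directions, while the union of their E_g has
density at most 1/2.

Such a union cannot exist (`MvPolynomial.false_of_planes`), by the method of multiplicities. A
nonzero polynomial of low degree vanishes to high order on the union. Its top homogeneous part then
vanishes to order m at v₀θ₀ + v₁θ₁ for each good pair v, where θ is a basis of the quadratic
extension K of F. Pairs of vectors in F^m correspond to points of K^m, so these points fill at least
half of K^m, contradicting Schwartz–Zippel with multiplicities over K once q ≥ 32m. -/

open MvPolynomial in
/-- The polynomial `P(X + a)`. -/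
noncomputable def MvPolynomial.shift {σ R : Type*} [CommRing R] (a : σ → R) :
    MvPolynomial σ R →ₐ[R] MvPolynomial σ R :=
  aeval fun i => X i + C (a i)

/-- All coefficients of `P` in degrees below `k` vanish. -/
def MvPolynomial.OrderGE {σ R : Type*} [CommSemiring R] (k : ℕ) (P : MvPolynomial σ R) : Prop :=
  ∀ α : σ →₀ ℕ, α.degree < k → coeff α P = 0

/-! ### Taylor shifts and zeros with multiplicity. -/

namespace MvPolynomial

section Shift

variable {σ R : Type*} [CommRing R]

@[simp] theorem shift_X (a : σ → R) (i : σ) : shift a (X i) = X i + C (a i) := by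
  simp [shift]

@[simp] theorem shift_C (a : σ → R) (r : R) : shift a (C r) = C r := by
  simp [shift]

theorem shift_shift (a b : σ → R) (P : MvPolynomial σ R) :
    shift a (shift b P) = shift (a + b) P := by
  have : (shift a).comp (shift b) = shift (a + b) := by
    ext i
    simp [add_assoc]
  exact DFunLike.congr_fun this P

theorem shift_zero (P : MvPolynomial σ R) : shift 0 P = P := by
  have : shift (0 : σ → R) = AlgHom.id R _ := by
    ext i
    simp
  exact DFunLike.congr_fun this P

theorem shift_injective (a : σ → R) : Function.Injective (shift a) := by
  refine Function.LeftInverse.injective (g := shift (-a)) fun P => ?_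
  rw [shift_shift, neg_add_cancel, shift_zero]

end Shift

/-- Separates translation in the first variable from translation in the others, so that the
Schwartz–Zippel induction can treat one line at a time. -/
theorem finSuccEquiv_shift {R : Type*} [CommRing R] {m : ℕ} (a₀ : R) (a : Fin m → R)
    (P : MvPolynomial (Fin (m + 1)) R) :
    finSuccEquiv R m (shift (Fin.cons a₀ a) P) =
      Polynomial.taylor (C a₀) ((finSuccEquiv R m P).map (shift a : _ →+* _)) := by
  induction P using MvPolynomial.induction_on with
  | C r => simp [finSuccEquiv_apply]
  | add p q hp hq => simp [hp, hq]
  | mul_X p i hp =>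
    rw [map_mul, map_mul, hp, map_mul, Polynomial.map_mul, Polynomial.taylor_mul, shift_X]
    congr 1
    refine Fin.cases ?_ (fun j => ?_) i
    · simp [finSuccEquiv_apply]
    · simp [finSuccEquiv_apply]

section Univariate

variable {K : Type*} [Field K] {m : ℕ}

/-- Applying `coeff α` to the coefficients of a polynomial over `MvPolynomial`. -/
noncomputable def coeffPolynomial (α : Fin m →₀ ℕ) (f : Polynomial (MvPolynomial (Fin m) K)) :
    Polynomial K :=
  ∑ j ∈ Finset.range (f.natDegree + 1), Polynomial.monomial j (coeff α (f.coeff j))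

theorem coeffPolynomial_coeff (α : Fin m →₀ ℕ) (f : Polynomial (MvPolynomial (Fin m) K)) (j : ℕ) :
    (coeffPolynomial α f).coeff j = coeff α (f.coeff j) := by
  simp only [coeffPolynomial, Polynomial.finsetSum_coeff, Polynomial.coeff_monomial,
    Finset.sum_ite_eq', Finset.mem_range]
  split_ifs with h
  · rfl
  · rw [Polynomial.coeff_eq_zero_of_natDegree_lt (by omega), coeff_zero]

theorem natDegree_coeffPolynomial_le (α : Fin m →₀ ℕ) (f : Polynomial (MvPolynomial (Fin m) K)) :
    (coeffPolynomial α f).natDegree ≤ f.natDegree := by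
  rw [Polynomial.natDegree_le_iff_coeff_eq_zero]
  intro j hj
  rw [coeffPolynomial_coeff, Polynomial.coeff_eq_zero_of_natDegree_lt hj, coeff_zero]

/-- Translation of the distinguished variable by a constant of K is K-linear on coefficients, so it
commutes with extracting the α-coefficient. -/
theorem coeff_taylor_coeffPolynomial (α : Fin m →₀ ℕ)
    (f : Polynomial (MvPolynomial (Fin m) K)) (a : K) (i : ℕ) :
    (Polynomial.taylor a (coeffPolynomial α f)).coeff i =
      coeff α ((Polynomial.taylor (C a) f).coeff i) := by
  conv_rhs => rw [f.as_sum_range]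
  simp only [coeffPolynomial, map_sum, Polynomial.finsetSum_coeff, coeff_sum,
    Polynomial.taylor_monomial]
  refine Finset.sum_congr rfl fun j _ => ?_
  rw [Polynomial.coeff_C_mul, Polynomial.coeff_C_mul, Polynomial.coeff_X_add_C_pow,
    Polynomial.coeff_X_add_C_pow, ← map_pow]
  have : ((j.choose i : ℕ) : MvPolynomial (Fin m) K) = C (j.choose i : K) := by simp
  rw [this, ← map_mul C, mul_comm (f.coeff j), coeff_C_mul, mul_comm]

end Univariate

theorem sum_rootMultiplicity_le {K : Type*} [Field K] [Fintype K] (Q : Polynomial K) :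
    ∑ a : K, Q.rootMultiplicity a ≤ Q.natDegree := by
  classical
  refine le_trans (le_of_eq ?_) (Polynomial.card_roots' Q)
  simp_rw [← Polynomial.count_roots]
  exact Multiset.sum_count_eq_card fun a _ => Finset.mem_univ a

theorem le_rootMultiplicity_of_coeff_taylor {K : Type*} [Field K] {Q : Polynomial K} (hQ : Q ≠ 0)
    (a : K) (k : ℕ) (h : ∀ i < k, (Polynomial.taylor a Q).coeff i = 0) :
    k ≤ Q.rootMultiplicity a := by
  rw [Polynomial.le_rootMultiplicity_iff hQ, Polynomial.X_sub_C_pow_dvd_iff,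
    Polynomial.X_pow_dvd_iff]
  exact h

theorem exists_coeff_ne_zero_minimal {σ R : Type*} [CommSemiring R] {P : MvPolynomial σ R}
    (hP : P ≠ 0) : ∃ α : σ →₀ ℕ, coeff α P ≠ 0 ∧ OrderGE α.degree P := by
  classical
  have hne : P.support.Nonempty := support_nonempty.2 hP
  obtain ⟨α, hα, hmin⟩ := P.support.exists_min_image Finsupp.degree hne
  refine ⟨α, mem_support_iff.1 hα, fun β hβ => ?_⟩
  by_contra h
  exact absurd (hmin β (mem_support_iff.2 h)) (not_le.2 hβ)

/-- Schwartz–Zippel lemma with multiplicities over a finite field. -/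
theorem card_mul_sum_le_totalDegree_mul {K : Type*} [Field K] [Fintype K] :
    ∀ (m : ℕ) (P : MvPolynomial (Fin m) K), P ≠ 0 → ∀ μ : (Fin m → K) → ℕ,
      (∀ a, OrderGE (μ a) (shift a P)) →
      Fintype.card K * ∑ a, μ a ≤ P.totalDegree * Fintype.card K ^ m
  | 0, P, hP, μ, hμ => by
    have : ∀ a, μ a = 0 := by
      intro a
      by_contra h
      have h0 := hμ a 0 (by simpa using Nat.pos_of_ne_zero h)
      apply hP
      apply shift_injective a
      rw [map_zero]
      ext α
      rw [Subsingleton.elim α 0, h0, coeff_zero]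
    simp [this]
  | m + 1, P, hP, μ, hμ => by
    set q := Fintype.card K with hq
    set f := finSuccEquiv K m P with hf
    have hf0 : f ≠ 0 := by simpa [hf] using hP
    set s := f.natDegree with hs
    have hlead : f.coeff s ≠ 0 := by
      simpa [hs] using hf0
    have hdeg : (f.coeff s).totalDegree + s ≤ P.totalDegree :=
      totalDegree_coeff_finSuccEquiv_add_le P s hlead
    -- For each a, |α| is the exact vanishing order at a of the leading coefficient in the first
    -- variable. The induction hypothesis bounds the sum of these orders.
    have hex : ∀ a : Fin m → K, ∃ α : Fin m →₀ ℕ, coeff α (shift a (f.coeff s)) ≠ 0 ∧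
        OrderGE α.degree (shift a (f.coeff s)) := fun a =>
      exists_coeff_ne_zero_minimal fun h => hlead (shift_injective a (by rw [h, map_zero]))
    choose α hα hord using hex
    have IH := card_mul_sum_le_totalDegree_mul m (f.coeff s) hlead (fun a => (α a).degree) hord
    -- On the line over a, extracting the α-coefficient costs at most |α| in vanishing order. It
    -- leaves a univariate polynomial of degree at most s that is nonzero by the choice of α, so its
    -- root multiplicities sum to at most s.
    have hfib : ∀ a : Fin m → K, ∑ a₀ : K, μ (Fin.cons a₀ a) ≤ q * (α a).degree + s := by
      intro a
      set g := f.map (shift a : MvPolynomial (Fin m) K →+* MvPolynomial (Fin m) K) with hg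
      set Q := coeffPolynomial (α a) g with hQdef
      have hQ0 : Q ≠ 0 := by
        intro h
        apply hα a
        have := coeffPolynomial_coeff (α a) g s
        rw [← hQdef, h, hg, Polynomial.coeff_map] at this
        simpa using this.symm
      have hQdeg : Q.natDegree ≤ s :=
        (natDegree_coeffPolynomial_le _ _).trans (Polynomial.natDegree_map_le)
      have hpt : ∀ a₀ : K, μ (Fin.cons a₀ a) ≤ (α a).degree + Q.rootMultiplicity a₀ := by
        intro a₀
        have : μ (Fin.cons a₀ a) - (α a).degree ≤ Q.rootMultiplicity a₀ := by
          refine le_rootMultiplicity_of_coeff_taylor hQ0 a₀ _ fun i hi => ?_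
          rw [hQdef, coeff_taylor_coeffPolynomial, hg, hf, ← finSuccEquiv_shift,
            finSuccEquiv_coeff_coeff]
          apply hμ
          rw [Finsupp.degree_eq_sum, Fin.sum_univ_succ]
          simp only [Finsupp.cons_zero, Finsupp.cons_succ]
          rw [← Finsupp.degree_eq_sum]
          omega
        omega
      calc ∑ a₀ : K, μ (Fin.cons a₀ a)
          ≤ ∑ a₀ : K, ((α a).degree + Q.rootMultiplicity a₀) := Finset.sum_le_sum fun a₀ _ => hpt a₀
        _ = q * (α a).degree + ∑ a₀ : K, Q.rootMultiplicity a₀ := by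
            simp [Finset.sum_add_distrib, hq]
        _ ≤ _ := by gcongr; exact (sum_rootMultiplicity_le Q).trans hQdeg
    have hsplit : ∑ a, μ a = ∑ a : Fin m → K, ∑ a₀ : K, μ (Fin.cons a₀ a) := by
      rw [← (Fin.consEquiv fun _ => K).sum_comp, Fintype.sum_prod_type, Finset.sum_comm]
      rfl
    calc q * ∑ a, μ a ≤ q * ∑ a : Fin m → K, (q * (α a).degree + s) := by
          rw [hsplit]; gcongr with a; exact hfib a
      _ = q * (q * ∑ a : Fin m → K, (α a).degree) + s * q ^ (m + 1) := by
          simp [Finset.sum_add_distrib, Finset.mul_sum, mul_add, hq]; ring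
      _ ≤ q * ((f.coeff s).totalDegree * q ^ m) + s * q ^ (m + 1) := by gcongr
      _ = ((f.coeff s).totalDegree + s) * q ^ (m + 1) := by ring
      _ ≤ _ := by gcongr

end MvPolynomial

/-! ### Interpolation with multiplicities by dimension count. -/

namespace MvPolynomial

open Finset Nat

/-- The exponents in `m` variables of degree below `k`. -/
def exponentsBelow (m k : ℕ) : Finset (Fin m →₀ ℕ) :=
  (range k).biUnion fun j => (univ : Finset (Fin m)).finsuppAntidiag j

theorem mem_exponentsBelow {m k : ℕ} {α : Fin m →₀ ℕ} :
    α ∈ exponentsBelow m k ↔ α.degree < k := by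
  simp [exponentsBelow, Finset.mem_finsuppAntidiag, Finsupp.degree_eq_sum]

theorem card_exponentsBelow_succ (m d : ℕ) : #(exponentsBelow m (d + 1)) = (d + m).choose m := by
  have hsum : #(exponentsBelow m (d + 1)) = ∑ j ∈ range (d + 1), (m + j - 1).choose j := by
    rw [exponentsBelow, card_biUnion]
    · simp [card_finsuppAntidiag_nat_eq_choose]
    · intro i _ j _ hij
      rw [Function.onFun, disjoint_left]
      intro α h1 h2
      rw [mem_finsuppAntidiag] at h1 h2
      exact hij (h1.1.symm.trans h2.1)
  rw [hsum, Nat.choose_symm_add.symm]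
  clear hsum
  induction d with
  | zero => simp
  | succ d ih =>
    rw [sum_range_succ, ih, show m + (d + 1) - 1 = d + m by omega,
      show d + 1 + m = d + m + 1 by omega, Nat.choose_succ_succ]

/-- The right side is the rising factorial k(k+1)⋯(k+m−1). This bound and the upper one that follows
reduce the interpolation condition to comparing m-th powers. -/
theorem pow_le_factorial_mul_card_exponentsBelow (m k : ℕ) (hk : 0 < k) :
    k ^ m ≤ m ! * #(exponentsBelow m k) := by
  obtain ⟨d, rfl⟩ := Nat.exists_eq_add_of_lt hk
  rw [zero_add, card_exponentsBelow_succ, ← Nat.ascFactorial_eq_factorial_mul_choose]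
  exact Nat.pow_succ_le_ascFactorial _ _

theorem factorial_mul_card_exponentsBelow_le (m k : ℕ) (hk : 0 < k) :
    m ! * #(exponentsBelow m k) ≤ (k + m) ^ m := by
  obtain ⟨d, rfl⟩ := Nat.exists_eq_add_of_lt hk
  rw [zero_add, card_exponentsBelow_succ, ← Nat.ascFactorial_eq_factorial_mul_choose]
  exact (Nat.ascFactorial_le_pow_add _ _).trans (Nat.pow_le_pow_left (by omega) _)

/-- Interpolation: a nonzero polynomial of bounded degree vanishing to high order on `E`. -/
theorem exists_orderGE_of_card_lt {F : Type*} [Field F] {m : ℕ} (E : Finset (Fin m → F))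
    (M d : ℕ) (h : #E * #(exponentsBelow m M) < #(exponentsBelow m (d + 1))) :
    ∃ P : MvPolynomial (Fin m) F, P ≠ 0 ∧ P.totalDegree ≤ d ∧
      ∀ e ∈ E, OrderGE M (shift e P) := by
  -- Φ records the vanishing conditions on polynomials of degree at most d. There are fewer
  -- conditions than coefficients, so its kernel is nonzero.
  let Φ : restrictSupport F (exponentsBelow m (d + 1) : Set (Fin m →₀ ℕ)) →ₗ[F] (E × exponentsBelow m M → F) :=
    LinearMap.pi fun x => (lcoeff F x.2.1).comp
      ((shift x.1.1 : MvPolynomial (Fin m) F →ₐ[F] _).toLinearMap.comp (Submodule.subtype _))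
  have b := basisRestrictSupport F (exponentsBelow m (d + 1) : Set (Fin m →₀ ℕ))
  have : Module.Finite F (restrictSupport F (exponentsBelow m (d + 1) : Set (Fin m →₀ ℕ))) := Module.Finite.of_basis b
  have hfin : Module.finrank F (restrictSupport F (exponentsBelow m (d + 1) : Set (Fin m →₀ ℕ))) = #(exponentsBelow m (d + 1)) := by
    rw [Module.finrank_eq_card_basis b]
    simp
  have hker : LinearMap.ker Φ ≠ ⊥ := by
    apply LinearMap.ker_ne_bot_of_finrank_lt
    rw [hfin, Module.finrank_fintype_fun_eq_card]
    simpa using h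
  obtain ⟨P, hP, hP0⟩ := Submodule.exists_mem_ne_zero_of_ne_bot hker
  refine ⟨P.1, fun h0 => hP0 (Subtype.ext h0), ?_, fun e he α hα => ?_⟩
  · rw [totalDegree, Finset.sup_le_iff]
    intro α hα
    have : α ∈ exponentsBelow m (d + 1) := (mem_restrictSupport_iff _).1 P.2 hα
    rw [mem_exponentsBelow] at this
    exact Nat.lt_succ_iff.1 this
  · exact congrFun (LinearMap.mem_ker.1 hP) (⟨e, he⟩, ⟨α, mem_exponentsBelow.2 hα⟩)

end MvPolynomial

/-! ### Linear substitutions, translations and homogeneous components. -/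

namespace MvPolynomial

open Finset

section LinearForms

variable {σ τ R : Type*} [CommRing R]

theorem orderGE_iff_homogeneousComponent {k : ℕ} {P : MvPolynomial σ R} :
    OrderGE k P ↔ ∀ j < k, homogeneousComponent j P = 0 := by
  constructor
  · intro h j hj
    ext α
    rw [coeff_homogeneousComponent, coeff_zero]
    split_ifs with hα
    · exact h α (hα ▸ hj)
    · rfl
  · intro h α hα
    have := congrArg (coeff α) (h _ hα)
    rwa [coeff_homogeneousComponent, if_pos rfl, coeff_zero] at this

/-- Substituting linear forms preserves the degree of each homogeneous piece. -/
theorem homogeneousComponent_aeval {g : σ → MvPolynomial τ R} (hg : ∀ i, (g i).IsHomogeneous 1)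
    (j : ℕ) (P : MvPolynomial σ R) :
    homogeneousComponent j (aeval g P) = aeval g (homogeneousComponent j P) := by
  have hhom : ∀ i, (aeval g (homogeneousComponent i P)).IsHomogeneous i := fun i => by
    simpa using (homogeneousComponent_isHomogeneous i P).aeval g hg
  conv_lhs => rw [← sum_homogeneousComponent P, map_sum, map_sum]
  have : ∀ i ∈ range (P.totalDegree + 1),
      homogeneousComponent j (aeval g (homogeneousComponent i P)) =
        if i = j then aeval g (homogeneousComponent j P) else 0 := fun i _ => by
    rw [homogeneousComponent_of_mem (hhom i)]
    by_cases h : i = j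
    · simp [h]
    · rw [if_neg (Ne.symm h), if_neg h]
  rw [sum_congr rfl this, sum_ite_eq']
  split_ifs with h
  · rfl
  · rw [homogeneousComponent_eq_zero _ _ (by simpa using h), map_zero]

theorem OrderGE.aeval {g : σ → MvPolynomial τ R} (hg : ∀ i, (g i).IsHomogeneous 1) {k : ℕ}
    {P : MvPolynomial σ R} (h : OrderGE k P) : OrderGE k (aeval g P) := by
  rw [orderGE_iff_homogeneousComponent] at h ⊢
  intro j hj
  rw [homogeneousComponent_aeval hg, h j hj, map_zero]

theorem coeff_aeval_eq_zero_of_totalDegree_lt {g : σ → MvPolynomial τ R}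
    (hg : ∀ i, (g i).IsHomogeneous 1) {P : MvPolynomial σ R} {γ : τ →₀ ℕ}
    (h : P.totalDegree < γ.degree) : coeff γ (aeval g P) = 0 := by
  have := congrArg (coeff γ) (homogeneousComponent_aeval hg γ.degree P)
  rwa [coeff_homogeneousComponent, if_pos rfl, homogeneousComponent_eq_zero _ _ h, map_zero,
    coeff_zero] at this

theorem coeff_shift_monomial [IsDomain R] (a : σ → R) (β : σ →₀ ℕ) (c : R) :
    ∀ γ : σ →₀ ℕ, (monomial β c).totalDegree ≤ γ.degree →
      coeff γ (shift a (monomial β c)) = coeff γ (monomial β c) := by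
  classical
  refine induction_on_monomial
    (motive := fun Q => ∀ γ : σ →₀ ℕ, Q.totalDegree ≤ γ.degree →
      coeff γ (shift a Q) = coeff γ Q) ?_ ?_ β c
  · intro c γ _
    simp
  · intro Q i hQ γ hγ
    by_cases hQ0 : Q = 0
    · simp [hQ0]
    rw [totalDegree_mul_of_isDomain hQ0 (X_ne_zero i), totalDegree_X] at hγ
    rw [map_mul, shift_X, mul_add, coeff_add, coeff_mul_X', coeff_mul_X', mul_comm (shift a Q) (C _),
      coeff_C_mul, hQ γ (by omega), coeff_eq_zero_of_totalDegree_lt (f := Q) (by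
        rw [← Finsupp.degree_apply]; omega), mul_zero, add_zero]
    split_ifs with hi
    · apply hQ
      have h1 : Finsupp.single i 1 ≤ γ := by
        rw [Finsupp.single_le_iff]
        exact Nat.one_le_iff_ne_zero.2 (Finsupp.mem_support_iff.1 hi)
      have h2 := congrArg Finsupp.degree (tsub_add_cancel_of_le h1)
      rw [map_add, Finsupp.degree_single] at h2
      omega
    · rfl

/-- Translation only creates terms of lower degree. Hence the top part forgets the base point of a
flat and sees only its directions. -/
theorem homogeneousComponent_shift [IsDomain R] (a : σ → R) {P : MvPolynomial σ R} {d : ℕ}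
    (hd : P.totalDegree ≤ d) :
    homogeneousComponent d (shift a P) = homogeneousComponent d P := by
  ext γ
  rw [coeff_homogeneousComponent, coeff_homogeneousComponent]
  split_ifs with hγ
  · conv_lhs => rw [P.as_sum, map_sum, coeff_sum]
    conv_rhs => rw [P.as_sum, coeff_sum]
    refine sum_congr rfl fun β hβ => coeff_shift_monomial a β _ γ ?_
    refine (totalDegree_monomial_le _ _).trans ?_
    rw [hγ]
    exact (le_totalDegree hβ).trans hd
  · rfl

theorem totalDegree_shift_le [IsDomain R] (a : σ → R) (P : MvPolynomial σ R) :
    (shift a P).totalDegree ≤ P.totalDegree := by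
  rw [totalDegree, Finset.sup_le_iff]
  intro γ hγ
  by_contra h
  push Not at h
  rw [mem_support_iff] at hγ
  apply hγ
  have h1 := congrArg (coeff γ) (homogeneousComponent_shift a (P := P) (d := γ.degree) h.le)
  rw [coeff_homogeneousComponent, coeff_homogeneousComponent, if_pos rfl, if_pos rfl] at h1
  rw [h1]
  exact coeff_eq_zero_of_totalDegree_lt h

theorem homogeneousComponent_totalDegree_ne_zero {P : MvPolynomial σ R} (hP : P ≠ 0) :
    homogeneousComponent P.totalDegree P ≠ 0 := by
  obtain ⟨β, hβ, hmax⟩ := P.support.exists_mem_eq_sup (support_nonempty.2 hP)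
    fun s => s.sum fun _ e => e
  intro h
  have := congrArg (coeff β) h
  rw [coeff_homogeneousComponent, if_pos (by rw [totalDegree, hmax]; rfl), coeff_zero] at this
  exact mem_support_iff.1 hβ this

theorem sumAlgEquiv_monomial (γ : σ ⊕ τ →₀ ℕ) (c : R) :
    sumAlgEquiv R σ τ (monomial γ c) =
      monomial (Finsupp.sumFinsuppEquivProdFinsupp γ).1
        (monomial (Finsupp.sumFinsuppEquivProdFinsupp γ).2 c) := by
  simp [sumAlgEquiv, monomial]

/-- Lets a polynomial in point variables X and parameters t be read as one in X whose coefficients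
are polynomials in t. -/
theorem coeff_coeff_sumAlgEquiv (T : MvPolynomial (σ ⊕ τ) R) (α : σ →₀ ℕ) (β : τ →₀ ℕ) :
    coeff β (coeff α (sumAlgEquiv R σ τ T)) = coeff (Finsupp.sumElim α β) T := by
  classical
  induction T using MvPolynomial.induction_on' with
  | add p q hp hq => simp [hp, hq]
  | monomial γ c =>
    obtain ⟨⟨α', β'⟩, rfl⟩ := Finsupp.sumFinsuppEquivProdFinsupp.symm.surjective γ
    have h : Finsupp.sumElim α β = Finsupp.sumFinsuppEquivProdFinsupp.symm (α, β) := rfl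
    rw [sumAlgEquiv_monomial, Equiv.apply_symm_apply, h, coeff_monomial, coeff_monomial]
    simp only [Equiv.apply_eq_iff_eq, Prod.mk.injEq]
    by_cases h1 : α' = α
    · simp [h1, coeff_monomial]
    · simp [h1]

theorem degree_sumElim [Fintype σ] [Fintype τ] (α : σ →₀ ℕ) (β : τ →₀ ℕ) :
    (Finsupp.sumElim α β).degree = α.degree + β.degree := by
  simp [Finsupp.degree_eq_sum]

end LinearForms

/-! ### Restriction of polynomials to flats. -/

section Plane

variable {σ τ F : Type*} [Field F]

theorem shift_coeff_sumAlgEquiv (s : τ → F) (T : MvPolynomial (σ ⊕ τ) F) (α : σ →₀ ℕ) :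
    shift s (coeff α (sumAlgEquiv F σ τ T)) =
      coeff α (sumAlgEquiv F σ τ (shift (Sum.elim 0 s) T)) := by
  have : (mapAlgHom (shift s)).comp (sumAlgEquiv F σ τ).toAlgHom =
      (sumAlgEquiv F σ τ).toAlgHom.comp (shift (Sum.elim 0 s)) := by
    ext1 i
    rcases i with i | i <;> simp
  have := congrArg (coeff α) (DFunLike.congr_fun this T)
  simpa [coeff_map] using this

variable [Fintype τ]

/-- Substitution of `X + ∑ j, t j • v j`, with new variables `t j`. -/
noncomputable def flatSubst (v : τ → σ → F) :
    MvPolynomial σ F →ₐ[F] MvPolynomial (σ ⊕ τ) F :=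
  aeval fun i => X (.inl i) + ∑ j, C (v j i) * X (.inr j)

theorem isHomogeneous_flatSubst_form (v : τ → σ → F) (i : σ) :
    (X (.inl i) + ∑ j, C (v j i) * X (.inr j) : MvPolynomial (σ ⊕ τ) F).IsHomogeneous 1 :=
  (isHomogeneous_X _ _).add (.sum _ _ _ fun _ _ => isHomogeneous_C_mul_X _ _)

theorem shift_flatSubst (v : τ → σ → F) (s : τ → F) (Q : MvPolynomial σ F) :
    shift (Sum.elim 0 s) (flatSubst v Q) = flatSubst v (shift (∑ j, s j • v j) Q) := by
  have : (shift (Sum.elim 0 s)).comp (flatSubst v) =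
      (flatSubst v).comp (shift (∑ j, s j • v j)) := by
    ext1 i
    simp [flatSubst, mul_add, sum_add_distrib, algebraMap_eq, mul_comm, add_assoc]
  exact DFunLike.congr_fun this Q

/-- Parameters may take values in K: a coefficient that vanishes identically in t therefore gives
vanishing at every K-point of the direction space. -/
theorem coeff_shift_map_eq_aeval {K : Type*} [Field K] [Algebra F K] (v : τ → σ → F) (θ : τ → K)
    (Q : MvPolynomial σ F) (α : σ →₀ ℕ) :
    coeff α (shift (fun i => ∑ j, v j i • θ j) (map (algebraMap F K) Q)) =
      aeval θ (coeff α (sumAlgEquiv F σ τ (flatSubst v Q))) := by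
  have : ((shift (fun i => ∑ j, v j i • θ j)).restrictScalars F).comp (mapAlgHom (Algebra.ofId F K)) =
      ((mapAlgHom (aeval θ)).comp (sumAlgEquiv F σ τ).toAlgHom).comp (flatSubst v) := by
    ext1 i
    simp [flatSubst, Algebra.smul_def]
  have := congrArg (coeff α) (DFunLike.congr_fun this Q)
  simpa [coeff_map] using this

/-- A polynomial vanishing to high order at enough points of a flat of dimension `k` has vanishing
low order coefficients along that flat. -/
theorem coeff_sumAlgEquiv_flatSubst_eq_zero [Fintype F] [DecidableEq F] {m k d M ℓ : ℕ}
    {P : MvPolynomial (Fin m) F} (hd : P.totalDegree ≤ d) (E : Finset (Fin m → F))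
    (hE : ∀ e ∈ E, OrderGE M (shift e P)) (a : Fin m → F) (v : Fin k → Fin m → F)
    (hcount : ∀ j < ℓ, (d - j) * Fintype.card F ^ k <
      Fintype.card F * (#{s : Fin k → F | a + ∑ i, s i • v i ∈ E} * (M - j)))
    (α : Fin m →₀ ℕ) (hα : α.degree < ℓ) :
    coeff α (sumAlgEquiv F (Fin m) (Fin k) (flatSubst v (shift a P))) = 0 := by
  by_contra hne
  -- c(t) is the coefficient of X^α in P(a + X + Σ tⱼvⱼ), that is, a Hasse derivative of P along the
  -- flat. Its degree is at most d − |α|, and it vanishes to order M − |α| at parameters of points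
  -- of E. Were it nonzero, `hcount` would contradict Schwartz–Zippel.
  set c := coeff α (sumAlgEquiv F (Fin m) (Fin k) (flatSubst v (shift a P))) with hc
  have hdeg : c.totalDegree ≤ d - α.degree := by
    rw [totalDegree, Finset.sup_le_iff]
    intro β hβ
    rw [mem_support_iff, hc, coeff_coeff_sumAlgEquiv] at hβ
    by_contra hlt
    apply hβ
    apply coeff_aeval_eq_zero_of_totalDegree_lt (isHomogeneous_flatSubst_form v)
    rw [degree_sumElim]
    have h1 := totalDegree_shift_le a P
    have h2 : β.degree = β.sum fun _ e => e := rfl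
    omega
  have hord : ∀ s : Fin k → F, a + ∑ i, s i • v i ∈ E → OrderGE (M - α.degree) (shift s c) := by
    intro s hs β hβ
    rw [hc, shift_coeff_sumAlgEquiv, coeff_coeff_sumAlgEquiv, shift_flatSubst, shift_shift]
    apply OrderGE.aeval (isHomogeneous_flatSubst_form v) (k := M)
    · rw [add_comm]
      exact hE _ hs
    · rw [degree_sumElim]
      omega
  have hsz := card_mul_sum_le_totalDegree_mul k c hne
    (fun s => if a + ∑ i, s i • v i ∈ E then M - α.degree else 0) (by
      intro s
      split_ifs with h
      · exact hord s h
      · intro β hβ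
        omega)
  rw [← sum_filter, sum_const, smul_eq_mul] at hsz
  have h3 := hcount _ hα
  have h4 : c.totalDegree * Fintype.card F ^ k ≤ (d - α.degree) * Fintype.card F ^ k := by gcongr
  omega

/-- The top homogeneous part of a polynomial vanishing to high order at enough points of a flat
vanishes to high order at all extension-field points of the direction space. -/
theorem orderGE_shift_map_homogeneousComponent [Fintype F] [DecidableEq F] {K : Type*} [Field K]
    [Algebra F K] {m k d M ℓ : ℕ}
    {P : MvPolynomial (Fin m) F} (hd : P.totalDegree ≤ d) (E : Finset (Fin m → F))
    (hE : ∀ e ∈ E, OrderGE M (shift e P)) (a : Fin m → F) (v : Fin k → Fin m → F)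
    (hcount : ∀ j < ℓ, (d - j) * Fintype.card F ^ k <
      Fintype.card F * (#{s : Fin k → F | a + ∑ i, s i • v i ∈ E} * (M - j)))
    (θ : Fin k → K) :
    OrderGE ℓ (shift (fun i => ∑ j, v j i • θ j)
      (map (algebraMap F K) (homogeneousComponent P.totalDegree P))) := by
  intro α hα
  rw [coeff_shift_map_eq_aeval]
  suffices coeff α (sumAlgEquiv F (Fin m) (Fin k)
      (flatSubst v (homogeneousComponent P.totalDegree P))) = 0 by rw [this, map_zero]
  ext β
  -- In total degree deg P, the top part of P can be replaced by P translated to a, whose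
  -- coefficients along the flat vanish. In other degrees the coefficient is zero by homogeneity.
  rw [coeff_coeff_sumAlgEquiv, ← homogeneousComponent_shift a le_rfl, flatSubst,
    ← homogeneousComponent_aeval (isHomogeneous_flatSubst_form v), coeff_homogeneousComponent]
  split_ifs with h
  · have := coeff_sumAlgEquiv_flatSubst_eq_zero hd E hE a v hcount α hα
    rw [← flatSubst, ← coeff_coeff_sumAlgEquiv, this]
  · simp

end Plane

end MvPolynomial

/-! ### The polynomial method for planes, over a quadratic extension. -/

theorem FiniteField.exists_quadratic_extension (F : Type*) [Field F] [Fintype F] :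
    ∃ (K : Type) (_ : Field K) (_ : Fintype K) (_ : Algebra F K), Module.finrank F K = 2 := by
  obtain ⟨p, hp⟩ := CharP.exists F
  have : Fact p.Prime := ⟨CharP.char_is_prime F p⟩
  exact ⟨FiniteField.Extension F p 2, inferInstance, Fintype.ofFinite _, inferInstance,
    FiniteField.finrank_extension F p 2⟩

namespace MvPolynomial

open Finset Nat

/-- By Bernoulli, (1 − 7/(16m+1))^m ≥ 1 − 7m/(16m+1) > 1/2. -/
theorem pow_lt_two_mul_pow (m : ℕ) (hm : 1 ≤ m) : (16 * m + 1) ^ m < 2 * (16 * m - 6) ^ m := by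
  obtain ⟨w, hw⟩ : ∃ w, 16 * m = w + 6 := ⟨16 * m - 6, by omega⟩
  have h1 : (1 + (m : ℝ) * (-7 / (16 * m + 1))) ≤ (1 + (-7 / (16 * m + 1) : ℝ)) ^ m := by
    apply one_add_mul_le_pow
    rw [le_div_iff₀ (by positivity)]
    have : (1 : ℝ) ≤ m := by exact_mod_cast hm
    linarith
  have h2 : (1 / 2 : ℝ) < 1 + (m : ℝ) * (-7 / (16 * m + 1)) := by
    have h : (m : ℝ) * (-7 / (16 * m + 1)) = -(7 * m) / (16 * m + 1) := by ring
    rw [h, ← sub_lt_iff_lt_add', lt_div_iff₀ (by positivity)]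
    have : (1 : ℝ) ≤ m := by exact_mod_cast hm
    linarith
  have h3 : (1 + (-7 / (16 * m + 1) : ℝ)) = (w : ℝ) / (16 * m + 1) := by
    have : (16 * m : ℝ) = w + 6 := by exact_mod_cast hw
    rw [this]
    field_simp
    ring
  rw [h3, div_pow] at h1
  have h4 := h2.trans_le h1
  rw [lt_div_iff₀ (by positivity)] at h4
  rw [show 16 * m - 6 = w by omega]
  have : ((16 * m + 1 : ℕ) : ℝ) ^ m < 2 * (w : ℝ) ^ m := by
    push_cast
    linarith
  exact_mod_cast this

/-- A set nearly containing a plane in at least half of all directions has density more than one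
half. -/
theorem false_of_planes {F : Type*} [Field F] [Fintype F] [DecidableEq F] {m : ℕ} (hm : 1 ≤ m)
    (hq : 32 * m ≤ Fintype.card F) (E : Finset (Fin m → F)) (hE : 2 * #E ≤ Fintype.card F ^ m)
    (Ω : Finset (Fin 2 → Fin m → F)) (hΩ : Fintype.card F ^ (2 * m) ≤ 2 * #Ω)
    (hplane : ∀ v ∈ Ω, ∃ a : Fin m → F, 4 * m * Fintype.card F ^ 2 ≤
      4 * m * #{s : Fin 2 → F | a + ∑ i, s i • v i ∈ E} + Fintype.card F ^ 2) : False := by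
  classical
  set q := Fintype.card F with hqdef
  have hq0 : 0 < q := by omega
  -- Two demands pin down d/q = 16m² − 6m. Interpolation on a set of density 1/2 needs 2(d/q)^m >
  -- (M+m)^m. Vanishing on planes needs d/q below (1 − 1/(4m))(M − m) = 16m² − 5m + 1/4.
  set M := 16 * m ^ 2 with hM
  set d := q * (m * (16 * m - 6)) with hd
  have hM0 : 0 < M := by positivity
  have hinterp : #E * #(exponentsBelow m M) < #(exponentsBelow m (d + 1)) := by
    have h1 := factorial_mul_card_exponentsBelow_le m M hM0
    have h2 := pow_le_factorial_mul_card_exponentsBelow m (d + 1) (by omega)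
    have h3 : (d : ℕ) ^ m ≤ (d + 1) ^ m := Nat.pow_le_pow_left (by omega) _
    have h4 : M + m = m * (16 * m + 1) := by rw [hM]; ring
    rw [h4, mul_pow] at h1
    rw [hd, mul_pow, mul_pow] at h3
    have h5 := pow_lt_two_mul_pow m hm
    have h6 : 0 < q ^ m * m ^ m := by positivity
    have h7 : (2 * #E) * (m ! * #(exponentsBelow m M)) ≤ q ^ m * (m ^ m * (16 * m + 1) ^ m) :=
      Nat.mul_le_mul hE h1
    have h8 : q ^ m * m ^ m * (16 * m + 1) ^ m < q ^ m * m ^ m * (2 * (16 * m - 6) ^ m) :=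
      Nat.mul_lt_mul_of_pos_left h5 h6
    have h9 : 2 * (m ! * (#E * #(exponentsBelow m M))) <
        2 * (m ! * #(exponentsBelow m (d + 1))) := by
      calc 2 * (m ! * (#E * #(exponentsBelow m M)))
          = (2 * #E) * (m ! * #(exponentsBelow m M)) := by ring
        _ ≤ q ^ m * (m ^ m * (16 * m + 1) ^ m) := h7
        _ = q ^ m * m ^ m * (16 * m + 1) ^ m := by ring
        _ < q ^ m * m ^ m * (2 * (16 * m - 6) ^ m) := h8
        _ = 2 * (q ^ m * (m ^ m * (16 * m - 6) ^ m)) := by ring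
        _ ≤ 2 * (m ! * #(exponentsBelow m (d + 1))) := Nat.mul_le_mul_left 2 (h3.trans h2)
    exact lt_of_mul_lt_mul_left (lt_of_mul_lt_mul_left h9 (by omega)) (by positivity)
  obtain ⟨P, hP0, hPd, hPE⟩ := exists_orderGE_of_card_lt E M d hinterp
  obtain ⟨K, _, _, _, hK⟩ := FiniteField.exists_quadratic_extension F
  have : FiniteDimensional F K := FiniteDimensional.of_finrank_pos (by omega)
  let θ : Module.Basis (Fin 2) F K := Module.finBasisOfFinrankEq F K hK
  have hKcard : Fintype.card K = q ^ 2 := by rw [Module.card_eq_pow_finrank (K := F), hK]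
  set Q := map (algebraMap F K) (homogeneousComponent P.totalDegree P) with hQ
  have hQ0 : Q ≠ 0 := by
    rw [hQ, Ne, map_eq_zero_iff _ (map_injective _ (algebraMap F K).injective)]
    exact homogeneousComponent_totalDegree_ne_zero hP0
  have hQd : Q.totalDegree ≤ d :=
    ((homogeneousComponent_isHomogeneous _ P).map _).totalDegree_le.trans hPd
  -- Since θ is a basis, distinct pairs give distinct points of K^m, and |K^m| = q^(2m). So `Ω`
  -- yields at least half of K^m.
  let pt : (Fin 2 → Fin m → F) → (Fin m → K) := fun v i => ∑ j, v j i • θ j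
  have hpt : Function.Injective pt := by
    intro v w h
    ext j i
    have := congrArg (fun x => θ.repr x j) (congrFun h i)
    simp only [pt, θ.repr_sum_self] at this
    exact this
  have hord : ∀ v ∈ Ω, OrderGE m (shift (pt v) Q) := by
    intro v hv
    obtain ⟨a, ha⟩ := hplane v hv
    refine orderGE_shift_map_homogeneousComponent hPd E hPE a v ?_ θ
    intro j hj
    rw [← hqdef]
    set N := #{s : Fin 2 → F | a + ∑ i, s i • v i ∈ E} with hN
    obtain ⟨w, rfl⟩ : ∃ w, m = w + 1 := ⟨m - 1, by omega⟩
    have h1 : 16 * (w + 1) ^ 2 - (w + 1) ≤ M - j := by omega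
    have h2 : 16 * (w + 1) ^ 2 - (w + 1) = (w + 1) * (16 * w + 15) := by
      rw [Nat.sub_eq_iff_eq_add (by nlinarith)]
      ring
    have h3 : 16 * (w + 1) - 6 = 16 * w + 10 := by omega
    have h4 : (w + 1) * (16 * w + 15) * N ≤ N * (M - j) := by
      rw [mul_comm N]
      gcongr
      omega
    have h5 : (4 * w + 3) * q ^ 2 ≤ 4 * (w + 1) * N := by
      have : 4 * (w + 1) * q ^ 2 = (4 * w + 3) * q ^ 2 + q ^ 2 := by ring
      omega
    have h6 : q * ((w + 1) * (16 * w + 10)) * q < N * (M - j) := by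
      refine lt_of_lt_of_le ?_ h4
      have h7 : 0 < q ^ 2 * (w + 1) := by positivity
      have h8 : (w + 1) * (16 * w + 15) * ((4 * w + 3) * q ^ 2) ≤
        (w + 1) * (16 * w + 15) * (4 * (w + 1) * N) := Nat.mul_le_mul_left _ h5
      -- With m = w + 1 this reads (16m − 6)·4m < (16m − 1)(4m − 1), where 4m − 1 accounts for the
      -- missing fraction of the plane.
      have h9 : (16 * w + 10) * (4 * (w + 1)) < (16 * w + 15) * (4 * w + 3) := by nlinarith
      have h10 := Nat.mul_lt_mul_of_pos_left h9 h7
      have : 4 * (w + 1) * (q * ((w + 1) * (16 * w + 10)) * q) <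
          4 * (w + 1) * ((w + 1) * (16 * w + 15) * N) := by nlinarith
      exact lt_of_mul_lt_mul_left this (by positivity)
    have h11 : (d - j) * q ≤ q * ((w + 1) * (16 * w + 10)) * q := by
      rw [hd, h3]
      exact Nat.mul_le_mul_right _ (Nat.sub_le _ _)
    calc (d - j) * q ^ 2 = q * ((d - j) * q) := by ring
      _ < q * (N * (M - j)) := Nat.mul_lt_mul_of_pos_left (h11.trans_lt h6) hq0
  -- Over K the field size is q², so multiplicity m on half of K^m gives q²m ≤ 2d, that is, q ≤
  -- 2(16m − 6) < 32m.
  have hsz := card_mul_sum_le_totalDegree_mul m Q hQ0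
    (fun u => if u ∈ Ω.image pt then m else 0) (by
      intro u
      split_ifs with h
      · obtain ⟨v, hv, rfl⟩ := mem_image.1 h
        exact hord v hv
      · intro β hβ
        omega)
  rw [← sum_filter, sum_const, smul_eq_mul, filter_univ_mem, card_image_of_injective _ hpt,
    hKcard, ← pow_mul] at hsz
  have h1 : Q.totalDegree * q ^ (2 * m) ≤ d * q ^ (2 * m) := by gcongr
  have h2 : q ^ 2 * (q ^ (2 * m) * m) ≤ 2 * (d * q ^ (2 * m)) := by
    calc q ^ 2 * (q ^ (2 * m) * m) ≤ q ^ 2 * (2 * #Ω * m) := by gcongr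
      _ = 2 * (q ^ 2 * (#Ω * m)) := by ring
      _ ≤ _ := by omega
  have h3 : q * m * q ^ (2 * m + 1) ≤ 2 * (m * (16 * m - 6)) * q ^ (2 * m + 1) := by
    calc q * m * q ^ (2 * m + 1) = q ^ 2 * (q ^ (2 * m) * m) := by ring
      _ ≤ 2 * (d * q ^ (2 * m)) := h2
      _ = _ := by rw [hd]; ring
  have h4 := le_of_mul_le_mul_right h3 (by positivity)
  have h5 : q ≤ 2 * (16 * m - 6) := by
    apply le_of_mul_le_mul_right (a := m) _ (by omega)
    calc q * m ≤ 2 * (m * (16 * m - 6)) := h4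
      _ = _ := by ring
  omega

end MvPolynomial

/-! ### Transitivity of the linear automorphisms. -/

section LinearMaps

variable {F V W U : Type*} [Field F] [AddCommGroup V] [Module F V] [AddCommGroup W] [Module F W]
  [AddCommGroup U] [Module F U]

/-- The linear automorphisms act transitively on the surjective linear maps. -/
theorem LinearMap.exists_comp_linearEquiv_eq [FiniteDimensional F V] {L₀ L : V →ₗ[F] U}
    (hL₀ : Function.Surjective L₀) (hL : Function.Surjective L) :
    ∃ g : V ≃ₗ[F] V, L₀ ∘ₗ g.toLinearMap = L := by
  obtain ⟨s₀, hs₀⟩ := L₀.exists_rightInverse_of_surjective (LinearMap.range_eq_top.2 hL₀)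
  obtain ⟨s, hs⟩ := L.exists_rightInverse_of_surjective (LinearMap.range_eq_top.2 hL)
  have hs₀' : ∀ u, L₀ (s₀ u) = u := fun u => LinearMap.congr_fun hs₀ u
  have hs' : ∀ u, L (s u) = u := fun u => LinearMap.congr_fun hs u
  have hrank : Module.finrank F (LinearMap.ker L) = Module.finrank F (LinearMap.ker L₀) := by
    have h1 := L.finrank_range_add_finrank_ker
    have h2 := L₀.finrank_range_add_finrank_ker
    rw [LinearMap.range_eq_top.2 hL] at h1
    rw [LinearMap.range_eq_top.2 hL₀] at h2
    omega
  let e := LinearEquiv.ofFinrankEq _ _ hrank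
  let π : V →ₗ[F] LinearMap.ker L := (LinearMap.id - s ∘ₗ L).codRestrict _ fun x => by
    simp [hs']
  -- Using sections of L and L₀, V splits as kernel plus a copy of U in two ways. The map g matches
  -- the copies of U and identifies the kernels, which have equal dimension.
  let g : V →ₗ[F] V := s₀ ∘ₗ L + (LinearMap.ker L₀).subtype ∘ₗ e.toLinearMap ∘ₗ π
  have hg : ∀ x, L₀ (g x) = L x := fun x => by
    have : L₀ (e (π x) : V) = 0 := (e (π x)).2
    simp [g, hs₀', this]
  have hinj : Function.Injective g := by
    rw [← LinearMap.ker_eq_bot, LinearMap.ker_eq_bot']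
    intro x hx
    have hLx : L x = 0 := by rw [← hg, hx, map_zero]
    have h1 : (e (π x) : V) = 0 := by simpa [g, hLx] using hx
    have h2 : π x = 0 := by simpa using h1
    have h3 := congrArg Subtype.val h2
    simpa [π, hLx] using h3
  exact ⟨LinearEquiv.ofInjectiveEndo g hinj, LinearMap.ext hg⟩

/-- The automorphisms preserving `L` act transitively on the nonzero vectors of its kernel. -/
theorem LinearMap.exists_linearEquiv_comp_eq_self [FiniteDimensional F V] (L : V →ₗ[F] U) {z z' : V}
    (hz : L z = 0) (hz' : L z' = 0) (hz0 : z ≠ 0) (hz0' : z' ≠ 0) :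
    ∃ h : V ≃ₗ[F] V, h z = z' ∧ L ∘ₗ h.toLinearMap = L := by
  -- If two functionals, one nonzero at z and one at z', both fail at the other vector, their sum
  -- works.
  obtain ⟨φ, hφz, hφz'⟩ : ∃ φ : Module.Dual F V, φ z = 1 ∧ φ z' ≠ 0 := by
    obtain ⟨ψ, hψ, hψ'⟩ : ∃ ψ : Module.Dual F V, ψ z ≠ 0 ∧ ψ z' ≠ 0 := by
      have hex : ∀ x : V, x ≠ 0 → ∃ ψ : Module.Dual F V, ψ x ≠ 0 := fun x hx => by
        by_contra! h
        exact hx ((Module.forall_dual_apply_eq_zero_iff F x).1 h)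
      obtain ⟨ψ₁, h₁⟩ := hex z hz0
      obtain ⟨ψ₂, h₂⟩ := hex z' hz0'
      by_cases h : ψ₁ z' = 0
      · by_cases h' : ψ₂ z = 0
        · exact ⟨ψ₁ + ψ₂, by simpa [h'] using h₁, by simpa [h] using h₂⟩
        · exact ⟨ψ₂, h', h₂⟩
      · exact ⟨ψ₁, h₁, h⟩
    exact ⟨(ψ z)⁻¹ • ψ, by simp [hψ], by simp [hψ, hψ']⟩
  -- A rank-one perturbation of the identity sending z to z'. It is invertible because φ(z') ≠ 0,
  -- and it preserves L because z' − z lies in ker L.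
  let h : V →ₗ[F] V := LinearMap.id + φ.smulRight (z' - z)
  have hinj : Function.Injective h := by
    rw [← LinearMap.ker_eq_bot, LinearMap.ker_eq_bot']
    intro x hx
    have hx' : x + φ x • (z' - z) = 0 := hx
    have h1 := congrArg φ hx'
    simp only [map_add, map_smul, map_sub, hφz, smul_eq_mul, map_zero] at h1
    have h2 : φ x = 0 := by
      have : φ x * φ z' = 0 := by linear_combination h1
      exact (mul_eq_zero.1 this).resolve_right hφz'
    simpa [h2] using hx'
  refine ⟨LinearEquiv.ofInjectiveEndo h hinj, ?_, LinearMap.ext fun x => ?_⟩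
  · simp [h, hφz]
  · simp [h, hz, hz']

end LinearMaps

/-! ### Random factorizations of a surjection and their second moments. -/

section Counting

open Finset

variable {F V W U : Type*} [Field F] [AddCommGroup V] [Module F V] [AddCommGroup W] [Module F W]
  [AddCommGroup U] [Module F U]

section Transporter

variable [Fintype (V ≃ₗ[F] V)] [DecidableEq (V →ₗ[F] U)]

/-- The automorphisms `g` with `L₀ ∘ g = L`. -/
def LinearMap.transporter (L₀ L : V →ₗ[F] U) : Finset (V ≃ₗ[F] V) :=
  {g | L₀ ∘ₗ g.toLinearMap = L}

theorem LinearMap.mem_transporter {L₀ L : V →ₗ[F] U} {g : V ≃ₗ[F] V} :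
    g ∈ L₀.transporter L ↔ L₀ ∘ₗ g.toLinearMap = L := by
  simp [LinearMap.transporter]

/-- Composing with an automorphism that carries L' to L is a bijection. So for surjective L₀ and
uniform g, the map L₀ ∘ g is uniform among surjections. -/
theorem LinearMap.card_transporter [FiniteDimensional F V] {L₀ L L' : V →ₗ[F] U}
    (hL : Function.Surjective L) (hL' : Function.Surjective L') :
    #(L₀.transporter L) = #(L₀.transporter L') := by
  obtain ⟨h, hh⟩ := LinearMap.exists_comp_linearEquiv_eq hL hL'
  refine card_bij' (fun g _ => h.trans g) (fun g _ => h.symm.trans g) ?_ ?_ ?_ ?_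
  · intro g hg
    rw [LinearMap.mem_transporter] at hg ⊢
    rw [← hh, ← hg]
    rfl
  · intro g hg
    rw [LinearMap.mem_transporter] at hg ⊢
    have : L = L' ∘ₗ h.symm.toLinearMap := by
      rw [← hh]
      ext x
      simp
    rw [this, ← hg]
    rfl
  · intro g _
    ext x
    simp
  · intro g _
    ext x
    simp

end Transporter

variable [Fintype V] [Fintype W] [Fintype U] [DecidableEq W] [DecidableEq U]

theorem LinearMap.card_fiber_mul_card {f : V →ₗ[F] U} (hf : Function.Surjective f) (y : U) :
    #{x | f x = y} * Fintype.card U = Fintype.card V := by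
  have h : ∀ y', #{x | f x = y'} = #{x | f x = y} := fun y' =>
    AddMonoidHom.card_fiber_eq_of_mem_range f.toAddMonoidHom (hf y') (hf y)
  have := card_eq_sum_card_fiberwise (s := (univ : Finset V)) (t := (univ : Finset U)) (f := f)
    (fun _ _ => mem_coe.2 (mem_univ _))
  rw [sum_congr rfl fun y' _ => h y', sum_const, card_univ, card_univ, smul_eq_mul, mul_comm] at this
  exact this.symm

variable [Fintype (V ≃ₗ[F] V)] [DecidableEq (V →ₗ[F] U)] [DecidableEq V]

/-- Pairwise independence of the maps `N ∘ g` given `M ∘ N ∘ g = L`. -/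
theorem LinearMap.mul_card_transporter_filter_le [FiniteDimensional F V] {N : V →ₗ[F] W}
    {M : W →ₗ[F] U} (hN : Function.Surjective N) {L : V →ₗ[F] U}
    (hL : Function.Surjective L) {k : ℕ} (hk : k * Fintype.card U = Fintype.card W)
    {z : V} (hz : L z = 0) (hz0 : z ≠ 0) :
    k * #{g ∈ (M ∘ₗ N).transporter L | N (g z) = 0} ≤ #((M ∘ₗ N).transporter L) := by
  set G := (M ∘ₗ N).transporter L with hG
  set c := #{g ∈ G | N (g z) = 0} with hc
  have hconst : ∀ z' : V, L z' = 0 → z' ≠ 0 → #{g ∈ G | N (g z') = 0} = c := by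
    intro z' hz' hz0'
    obtain ⟨h, hhz, hLh⟩ := L.exists_linearEquiv_comp_eq_self hz hz' hz0 hz0'
    have hhz' : h.symm z' = z := by rw [← hhz, LinearEquiv.symm_apply_apply]
    refine card_bij' (fun g _ => h.trans g) (fun g _ => h.symm.trans g) ?_ ?_ ?_ ?_
    · intro g hg
      rw [mem_filter, hG, LinearMap.mem_transporter] at hg ⊢
      refine ⟨?_, by simpa [hhz] using hg.2⟩
      rw [← hLh, ← hg.1]
      rfl
    · intro g hg
      rw [mem_filter, hG, LinearMap.mem_transporter] at hg ⊢
      refine ⟨?_, by simpa [hhz'] using hg.2⟩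
      have : L = L ∘ₗ h.symm.toLinearMap := by
        conv_rhs => rw [← hLh]
        ext x
        simp
      conv_rhs => rw [this, ← hg.1]
      rfl
    · intro g _
      ext x
      simp
    · intro g _
      ext x
      simp
  -- The count c is the same for all nonzero kernel vectors, so double counting pairs (z', g) gives
  -- c(|ker L| − 1) = |G|(|ker N| − 1).
  set Z : Finset V := {x | L x = 0 ∧ x ≠ 0} with hZ
  have hsum : ∑ z' ∈ Z, #{g ∈ G | N (g z') = 0} = ∑ g ∈ G, #{z' ∈ Z | N (g z') = 0} :=
    sum_card_bipartiteAbove_eq_sum_card_bipartiteBelow (fun (z' : V) (g : V ≃ₗ[F] V) => N (g z') = 0)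
  have hlhs : ∑ z' ∈ Z, #{g ∈ G | N (g z') = 0} = #Z * c := by
    rw [sum_congr rfl fun z' hz' => hconst z' (mem_filter.1 hz').2.1 (mem_filter.1 hz').2.2,
      sum_const, smul_eq_mul]
  have hZcard : #Z + 1 = #{x | L x = 0} := by
    have : Z = ({x | L x = 0} : Finset V).erase 0 := by
      ext x
      simp [hZ, and_comm]
    rw [this, card_erase_add_one (by simp)]
  have hkerN : ∀ g ∈ G, #{z' ∈ Z | N (g z') = 0} + 1 = #{x | N x = 0} := by
    intro g hg
    rw [hG, LinearMap.mem_transporter] at hg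
    have : ({z' ∈ Z | N (g z') = 0} : Finset V) =
        (({x | N x = 0} : Finset V).erase 0).map g.symm.toEquiv.toEmbedding := by
      ext x
      simp only [hZ, mem_filter, mem_univ, true_and, mem_map_equiv, mem_erase]
      have h1 : g.symm.toEquiv.symm x = g x := rfl
      rw [h1, ← hg]
      simp only [LinearMap.comp_apply, LinearEquiv.coe_coe]
      constructor
      · rintro ⟨⟨_, h2⟩, h3⟩
        exact ⟨by simpa using h2, h3⟩
      · rintro ⟨h2, h3⟩
        exact ⟨⟨by rw [h3, map_zero], by simpa using h2⟩, h3⟩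
    rw [this, card_map, card_erase_add_one (by simp)]
  set A := #{x | N x = 0} with hA
  have hrhs : ∑ g ∈ G, #{z' ∈ Z | N (g z') = 0} = #G * (A - 1) := by
    rw [sum_congr rfl fun g hg => show _ = A - 1 by have := hkerN g hg; omega, sum_const,
      smul_eq_mul]
  have hkA : k * A = #Z + 1 := by
    have h1 := LinearMap.card_fiber_mul_card hN 0
    have h2 := LinearMap.card_fiber_mul_card hL 0
    rw [hZcard]
    have hU : 0 < Fintype.card U := Fintype.card_pos_iff.2 ⟨0⟩
    apply Nat.eq_of_mul_eq_mul_right hU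
    rw [h2, ← h1, ← hk]
    ring
  have hZ0 : 0 < #Z := card_pos.2 ⟨z, by simp [hZ, hz, hz0]⟩
  have hA0 : 0 < A := card_pos.2 ⟨0, by simp⟩
  obtain ⟨B, hB⟩ : ∃ B, A = B + 1 := ⟨A - 1, by omega⟩
  have hk0 : 0 < k := Nat.pos_of_ne_zero fun h => by simp [h] at hkA
  rw [hlhs, hrhs, hB, Nat.add_sub_cancel] at hsum
  -- Since |ker L| = k|ker N|, the ratio (A − 1)/(kA − 1) is at most 1/k. Excluding the zero vector
  -- only helps.
  have h1 : k * B ≤ #Z := by rw [hB] at hkA; nlinarith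
  apply le_of_mul_le_mul_left _ hZ0
  calc #Z * (k * c) = k * (#Z * c) := by ring
    _ = #G * (k * B) := by rw [hsum]; ring
    _ ≤ #G * #Z := Nat.mul_le_mul_left _ h1
    _ = _ := mul_comm _ _

/-- Second moment bound for the fiber sizes of `N ∘ g` on `S`, given `M ∘ N ∘ g = L`. -/
theorem LinearMap.sum_transporter_sq_le [FiniteDimensional F V] {N : V →ₗ[F] W}
    {M : W →ₗ[F] U} (hN : Function.Surjective N) (hM : Function.Surjective M) {L : V →ₗ[F] U}
    (hL : Function.Surjective L) {k : ℕ} (hk : k * Fintype.card U = Fintype.card W)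
    (S : Finset V) (y : U) :
    ∑ g ∈ (M ∘ₗ N).transporter L, ∑ p with M p = y,
        ((#{x ∈ S | N (g x) = p} : ℝ) - #{x ∈ S | L x = y} / k) ^ 2 ≤
      #((M ∘ₗ N).transporter L) * #{x ∈ S | L x = y} := by
  set G := (M ∘ₗ N).transporter L with hG
  set X : Finset V := {x ∈ S | L x = y} with hX
  have hW : 0 < Fintype.card W := Fintype.card_pos_iff.2 ⟨0⟩
  have hk0 : 0 < k := Nat.pos_of_ne_zero fun h => by simp [h] at hk; omega
  have hfib : #{p | M p = y} = k := by
    have h := LinearMap.card_fiber_mul_card hM y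
    rw [← hk] at h
    exact Nat.eq_of_mul_eq_mul_right (Fintype.card_pos_iff.2 ⟨0⟩) h
  have hMN : ∀ g ∈ G, ∀ x, M (N (g x)) = L x := fun g hg x =>
    LinearMap.congr_fun (LinearMap.mem_transporter.1 hg) x
  have hw : ∀ g ∈ G, ∀ p, M p = y → #{x ∈ S | N (g x) = p} = #{x ∈ X | N (g x) = p} := by
    intro g hg p hp
    congr 1
    ext x
    simp only [hX, mem_filter]
    constructor
    · rintro ⟨h1, h2⟩
      exact ⟨⟨h1, by rw [← hMN g hg, h2, hp]⟩, h2⟩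
    · rintro ⟨⟨h1, _⟩, h2⟩
      exact ⟨h1, h2⟩
  have hmaps : ∀ g ∈ G, Set.MapsTo (fun x => N (g x)) (X : Set V)
      (({p | M p = y} : Finset W) : Set W) := by
    intro g hg x hx
    simp only [coe_filter, mem_univ, true_and, Set.mem_ofPred_eq]
    rw [hMN g hg]
    exact (mem_filter.1 (mem_coe.1 hx)).2
  have hsum1 : ∀ g ∈ G, ∑ p with M p = y, (#{x ∈ X | N (g x) = p} : ℝ) = #X := by
    intro g hg
    have := card_eq_sum_card_fiberwise (hmaps g hg)
    rw [this]
    push_cast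
    rfl
  have hsum2 : ∀ g ∈ G, ∑ p with M p = y, #{x ∈ X | N (g x) = p} ^ 2 =
      ∑ x ∈ X, ∑ x' ∈ X, if N (g (x - x')) = 0 then 1 else 0 := by
    intro g hg
    have h1 : ∀ p, #{x ∈ X | N (g x) = p} ^ 2 =
        ∑ x ∈ X, if N (g x) = p then #{x' ∈ X | N (g x') = p} else 0 := by
      intro p
      rw [← sum_filter, sum_const, smul_eq_mul, sq]
    simp_rw [h1]
    rw [sum_comm]
    refine sum_congr rfl fun x hx => ?_
    rw [sum_ite_eq]
    rw [if_pos (mem_coe.1 (hmaps g hg hx)), card_filter]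
    refine sum_congr rfl fun x' _ => ?_
    simp only [map_sub, sub_eq_zero]
    exact if_congr eq_comm rfl rfl
  -- Squared fiber sizes count colliding pairs. Diagonal pairs always collide, and each other pair
  -- collides for at most |G|/k of the g.
  have hpair : (k : ℝ) * ∑ g ∈ G, ∑ p with M p = y, (#{x ∈ X | N (g x) = p} : ℝ) ^ 2 ≤
      #G * (k * #X + #X ^ 2) := by
    have h1 : k * ∑ g ∈ G, ∑ p with M p = y, #{x ∈ X | N (g x) = p} ^ 2 ≤
        #G * (k * #X + #X ^ 2) := by
      rw [sum_congr rfl hsum2, sum_comm]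
      have h2 : ∀ x ∈ X, k * ∑ g ∈ G, ∑ x' ∈ X, (if N (g (x - x')) = 0 then 1 else 0) ≤
          #G * (k + #X) := by
        intro x hx
        rw [sum_comm]
        have h3 : ∀ x' ∈ X, k * ∑ g ∈ G, (if N (g (x - x')) = 0 then 1 else 0) ≤
            (if x = x' then k * #G else 0) + #G := by
          intro x' hx'
          rw [← card_filter]
          split_ifs with h
          · exact (Nat.mul_le_mul_left _ (card_filter_le _ _)).trans (Nat.le_add_right _ _)
          · rw [zero_add]
            refine LinearMap.mul_card_transporter_filter_le hN hL hk ?_ (sub_ne_zero.2 h)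
            rw [map_sub, (mem_filter.1 hx).2, (mem_filter.1 hx').2, sub_self]
        rw [mul_sum]
        refine (sum_le_sum h3).trans ?_
        rw [sum_add_distrib, sum_ite_eq, if_pos hx, sum_const, smul_eq_mul]
        apply le_of_eq
        ring
      rw [mul_sum]
      refine (sum_le_sum h2).trans ?_
      rw [sum_const, smul_eq_mul]
      apply le_of_eq
      ring
    exact_mod_cast h1
  have hkR : (0 : ℝ) < k := by exact_mod_cast hk0
  have hexp : ∀ g ∈ G, ∑ p with M p = y, ((#{x ∈ S | N (g x) = p} : ℝ) - #X / k) ^ 2 =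
      ∑ p with M p = y, (#{x ∈ X | N (g x) = p} : ℝ) ^ 2 - #X ^ 2 / k := by
    intro g hg
    have h1 : ∀ p ∈ ({p | M p = y} : Finset W), ((#{x ∈ S | N (g x) = p} : ℝ) - #X / k) ^ 2 =
        (#{x ∈ X | N (g x) = p} : ℝ) ^ 2 - 2 * (#X / k) * #{x ∈ X | N (g x) = p} + (#X / k) ^ 2 := by
      intro p hp
      rw [hw g hg p (mem_filter.1 hp).2]
      ring
    rw [sum_congr rfl h1, sum_add_distrib, sum_sub_distrib, ← mul_sum, hsum1 g hg, sum_const, hfib,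
      nsmul_eq_mul]
    field_simp
    ring
  rw [sum_congr rfl hexp, sum_sub_distrib, sum_const, nsmul_eq_mul]
  have h5 : ∑ g ∈ G, ∑ p with M p = y, (#{x ∈ X | N (g x) = p} : ℝ) ^ 2 ≤
      #G * (k * #X + #X ^ 2) / k := by
    rw [le_div_iff₀ hkR, mul_comm]
    exact hpair
  calc _ ≤ (#G : ℝ) * (k * #X + #X ^ 2) / k - #G * (#X ^ 2 / k) := by gcongr
    _ = _ := by field_simp; ring

end Counting

/-! ### Deviating points and greedy covering. -/

section Averaging

open Finset

section Deviation

variable {F V W U : Type*} [Field F] [AddCommGroup V] [Module F V] [AddCommGroup W] [Module F W]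
  [AddCommGroup U] [Module F U] [DecidableEq W]

/-- The points whose fiber under `f` in `S` has size at distance at least `ρ` from `μ`. -/
noncomputable def deviationSet [Fintype W] (S : Finset V) (f : V → W) (ρ μ : ℝ) : Finset W :=
  {p | ρ ≤ |(#{x ∈ S | f x = p} : ℝ) - μ|}

omit [AddCommGroup V] [AddCommGroup W] in
theorem mem_deviationSet [Fintype W] {S : Finset V} {f : V → W} {ρ μ : ℝ} {p : W} :
    p ∈ deviationSet S f ρ μ ↔ ρ ≤ |(#{x ∈ S | f x = p} : ℝ) - μ| := by
  simp [deviationSet]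

variable [Fintype V] [Fintype W] [Fintype U] [DecidableEq U] [Fintype (V ≃ₗ[F] V)]
  [DecidableEq (V →ₗ[F] U)]

/-- If the fiber of `L` over `y` deviates, then for at least half of the factorizations
`L = M ∘ N ∘ g`, almost all points over `y` deviate. -/
theorem card_transporter_le_two_mul [FiniteDimensional F V] {N : V →ₗ[F] W}
    {M : W →ₗ[F] U} (hN : Function.Surjective N) (hM : Function.Surjective M) {L : V →ₗ[F] U}
    (hL : Function.Surjective L) {k : ℕ} (hk : k * Fintype.card U = Fintype.card W)
    (S : Finset V) (y : U) {τ μ b : ℝ} (hτ : 0 < τ) (hμ : 0 < μ) (hb : 8 * (1 + τ) ≤ b * μ * τ ^ 2)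
    (hdev : τ * (μ * k) < |(#{x ∈ S | L x = y} : ℝ) - μ * k|) :
    (#((M ∘ₗ N).transporter L) : ℝ) ≤ 2 * #{g ∈ (M ∘ₗ N).transporter L |
      (#{p | M p = y ∧ p ∉ deviationSet S (fun x => N (g x)) (τ * μ / 2) μ} : ℝ) ≤ b * k} := by
  classical
  set G := (M ∘ₗ N).transporter L with hG
  set X : Finset V := {x ∈ S | L x = y} with hX
  have hW : 0 < Fintype.card W := Fintype.card_pos_iff.2 ⟨0⟩
  have hk0 : 0 < k := Nat.pos_of_ne_zero fun h => by simp [h] at hk; omega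
  have hkR : (0 : ℝ) < k := by exact_mod_cast hk0
  have hb0 : 0 < b := by
    by_contra h
    have : b * μ * τ ^ 2 ≤ 0 := by
      rw [mul_assoc]
      exact mul_nonpos_of_nonpos_of_nonneg (not_lt.1 h) (by positivity)
    linarith
  set D := |(#X : ℝ) / k - μ| with hD
  have hDX : |(#X : ℝ) - μ * k| = D * k := by
    rw [hD, ← abs_of_pos hkR, ← abs_mul, abs_of_pos hkR, sub_mul, div_mul_cancel₀ _ hkR.ne']
  have hDτ : τ * μ < D := by
    rw [hDX, ← mul_assoc] at hdev
    exact lt_of_mul_lt_mul_right hdev hkR.le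
  have hD0 : 0 < D := (mul_pos hτ hμ).trans hDτ
  have hXD : (#X : ℝ) / k ≤ μ + D := by
    have := le_abs_self ((#X : ℝ) / k - μ)
    linarith
  set B : Finset (V ≃ₗ[F] V) := {g ∈ G |
    ¬ (#{p | M p = y ∧ p ∉ deviationSet S (fun x => N (g x)) (τ * μ / 2) μ} : ℝ) ≤ b * k} with hB
  have hsplit := card_filter_add_card_filter_not (s := G) (fun g : V ≃ₗ[F] V =>
    (#{p | M p = y ∧ p ∉ deviationSet S (fun x => N (g x)) (τ * μ / 2) μ} : ℝ) ≤ b * k)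
  have hmoment := LinearMap.sum_transporter_sq_le hN hM hL hk S y
  rw [← hG, ← hX] at hmoment
  -- The conditional mean |X|/k is at distance D > τμ from μ. A fiber within τμ/2 of μ is thus at
  -- least D/2 from that mean, and many such fibers would make the second moment too large.
  have hlow : ∀ g ∈ B, b * k * (D / 2) ^ 2 ≤
      ∑ p with M p = y, ((#{x ∈ S | N (g x) = p} : ℝ) - #X / k) ^ 2 := by
    intro g hg
    have h1 := (not_le.1 (mem_filter.1 hg).2).le
    calc b * k * (D / 2) ^ 2
        ≤ #{p | M p = y ∧ p ∉ deviationSet S (fun x => N (g x)) (τ * μ / 2) μ} * (D / 2) ^ 2 := by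
          gcongr
      _ = ∑ p with M p = y ∧ p ∉ deviationSet S (fun x => N (g x)) (τ * μ / 2) μ,
            (D / 2) ^ 2 := by rw [sum_const, nsmul_eq_mul]
      _ ≤ ∑ p with M p = y ∧ p ∉ deviationSet S (fun x => N (g x)) (τ * μ / 2) μ,
            ((#{x ∈ S | N (g x) = p} : ℝ) - #X / k) ^ 2 := by
          refine sum_le_sum fun p hp => ?_
          have hp2 := (mem_filter.1 hp).2.2
          rw [mem_deviationSet, not_le] at hp2
          rw [← sq_abs (_ - _)]
          refine pow_le_pow_left₀ (by positivity) ?_ 2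
          have h3 := abs_sub_le ((#X : ℝ) / k) (#{x ∈ S | N (g x) = p} : ℝ) μ
          rw [abs_sub_comm ((#X : ℝ) / k) (#{x ∈ S | N (g x) = p} : ℝ), ← hD] at h3
          linarith
      _ ≤ _ := by
          refine sum_le_sum_of_subset_of_nonneg ?_ fun _ _ _ => sq_nonneg _
          intro p hp
          simp only [mem_filter, mem_univ, true_and] at hp ⊢
          exact hp.1
  have hBG : (#B : ℝ) * (b * k * (D / 2) ^ 2) ≤ #G * #X := by
    calc (#B : ℝ) * (b * k * (D / 2) ^ 2) = ∑ g ∈ B, b * k * (D / 2) ^ 2 := by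
          rw [sum_const, nsmul_eq_mul]
      _ ≤ ∑ g ∈ B, ∑ p with M p = y, ((#{x ∈ S | N (g x) = p} : ℝ) - #X / k) ^ 2 :=
          sum_le_sum hlow
      _ ≤ ∑ g ∈ G, ∑ p with M p = y, ((#{x ∈ S | N (g x) = p} : ℝ) - #X / k) ^ 2 :=
          sum_le_sum_of_subset_of_nonneg (filter_subset _ _)
            fun _ _ _ => sum_nonneg fun _ _ => sq_nonneg _
      _ ≤ _ := hmoment
  -- (μ + D)/D² decreases in D, so the worst case is D = τμ, which is exactly `hb`. The 8 combines 4
  -- from (D/2)² with 2 from asking for half of `G`.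
  have hkey : 8 * (μ + D) ≤ b * D ^ 2 := by
    have h1 : (μ + D) * (μ * τ ^ 2) ≤ D ^ 2 * (1 + τ) := by
      have h2 : 0 ≤ (D - τ * μ) * (D + τ * μ + τ * D) :=
        mul_nonneg (by linarith) (by positivity)
      nlinarith
    have h3 : 8 * (μ + D) * (μ * τ ^ 2) ≤ b * D ^ 2 * (μ * τ ^ 2) := by
      calc 8 * (μ + D) * (μ * τ ^ 2) ≤ D ^ 2 * (8 * (1 + τ)) := by linarith
        _ ≤ D ^ 2 * (b * μ * τ ^ 2) := by gcongr
        _ = _ := by ring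
    exact le_of_mul_le_mul_right h3 (by positivity)
  have hXk : (#X : ℝ) = (#X : ℝ) / k * k := by field_simp
  have hB2 : 2 * (#B : ℝ) ≤ #G := by
    have h1 : 2 * (#B : ℝ) * (k * (μ + D)) ≤ #G * (k * (μ + D)) := by
      calc 2 * (#B : ℝ) * (k * (μ + D)) = #B * (k * (8 * (μ + D)) / 4) := by ring
        _ ≤ #B * (k * (b * D ^ 2) / 4) := by
            refine mul_le_mul_of_nonneg_left ?_ (Nat.cast_nonneg _)
            linarith [mul_le_mul_of_nonneg_left hkey hkR.le]
        _ = #B * (b * k * (D / 2) ^ 2) := by ring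
        _ ≤ #G * #X := hBG
        _ = #G * ((#X : ℝ) / k * k) := by rw [← hXk]
        _ ≤ #G * ((μ + D) * k) :=
            mul_le_mul_of_nonneg_left (mul_le_mul_of_nonneg_right hXD hkR.le) (Nat.cast_nonneg _)
        _ = _ := by ring
    exact le_of_mul_le_mul_right h1 (by positivity)
  have hsplitR : (#{g ∈ G | (#{p | M p = y ∧ p ∉ deviationSet S (fun x => N (g x)) (τ * μ / 2) μ} : ℝ)
      ≤ b * k} : ℝ) + #B = #G := by exact_mod_cast hsplit
  linarith

-- Chebyshev's inequality for an unconditioned random g, from the same second moment bound.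
omit [Fintype U] [DecidableEq U] [DecidableEq (V →ₗ[F] U)] in
theorem card_dense_deviationSet_mul_le [FiniteDimensional F V] {N : V →ₗ[F] W}
    (hN : Function.Surjective N) (S : Finset V) {ρ μ a : ℝ} (hρ : 0 ≤ ρ)
    (hμ : μ * Fintype.card W = #S) :
    (#{g : V ≃ₗ[F] V | a * Fintype.card W < #(deviationSet S (fun x => N (g x)) ρ μ)} : ℝ) *
      (a * ρ ^ 2) ≤ Fintype.card (V ≃ₗ[F] V) * μ := by
  classical
  have hW : (0 : ℝ) < Fintype.card W := by exact_mod_cast Fintype.card_pos_iff.2 ⟨0⟩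
  -- With a zero-dimensional target the constraint M ∘ N ∘ g = L is empty, so the transporter is the
  -- whole automorphism group.
  have hsurjV : Function.Surjective (0 : V →ₗ[F] (Fin 0 → F)) := fun y => ⟨0, Subsingleton.elim _ _⟩
  have hsurjW : Function.Surjective (0 : W →ₗ[F] (Fin 0 → F)) := fun y => ⟨0, Subsingleton.elim _ _⟩
  have h := LinearMap.sum_transporter_sq_le (M := (0 : W →ₗ[F] (Fin 0 → F))) hN hsurjW
    (L := 0) hsurjV (k := Fintype.card W) (by simp) S 0
  have htr : ((0 : W →ₗ[F] (Fin 0 → F)) ∘ₗ N).transporter 0 = univ := by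
    ext g
    simp [LinearMap.mem_transporter]
  rw [htr] at h
  simp only [LinearMap.zero_apply, filter_true, ← hμ] at h
  rw [mul_div_cancel_right₀ _ hW.ne', card_univ] at h
  set B : Finset (V ≃ₗ[F] V) :=
    {g | a * Fintype.card W < #(deviationSet S (fun x => N (g x)) ρ μ)} with hB
  have hlow : ∀ g ∈ B, a * Fintype.card W * ρ ^ 2 ≤
      ∑ p, ((#{x ∈ S | N (g x) = p} : ℝ) - μ) ^ 2 := by
    intro g hg
    calc a * Fintype.card W * ρ ^ 2 ≤ #(deviationSet S (fun x => N (g x)) ρ μ) * ρ ^ 2 := by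
          gcongr
          exact (mem_filter.1 hg).2.le
      _ = ∑ p ∈ deviationSet S (fun x => N (g x)) ρ μ, ρ ^ 2 := by rw [sum_const, nsmul_eq_mul]
      _ ≤ ∑ p ∈ deviationSet S (fun x => N (g x)) ρ μ, ((#{x ∈ S | N (g x) = p} : ℝ) - μ) ^ 2 := by
          refine sum_le_sum fun p hp => ?_
          rw [← sq_abs (_ - _)]
          exact pow_le_pow_left₀ hρ (mem_deviationSet.1 hp) 2
      _ ≤ _ := sum_le_sum_of_subset_of_nonneg (subset_univ _) fun _ _ _ => sq_nonneg _
  have h2 : (#B : ℝ) * (a * Fintype.card W * ρ ^ 2) ≤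
      Fintype.card (V ≃ₗ[F] V) * (μ * Fintype.card W) := by
    calc (#B : ℝ) * (a * Fintype.card W * ρ ^ 2) = ∑ g ∈ B, a * Fintype.card W * ρ ^ 2 := by
          rw [sum_const, nsmul_eq_mul]
      _ ≤ ∑ g ∈ B, ∑ p, ((#{x ∈ S | N (g x) = p} : ℝ) - μ) ^ 2 := sum_le_sum hlow
      _ ≤ ∑ g : V ≃ₗ[F] V, ∑ p, ((#{x ∈ S | N (g x) = p} : ℝ) - μ) ^ 2 :=
          sum_le_sum_of_subset_of_nonneg (subset_univ _)
            fun _ _ _ => sum_nonneg fun _ _ => sq_nonneg _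
      _ ≤ _ := h
  refine le_of_mul_le_mul_right ?_ hW
  calc _ = (#B : ℝ) * (a * Fintype.card W * ρ ^ 2) := by ring
    _ ≤ _ := h2
    _ = _ := by ring

end Deviation

/-- Greedy covering: if every point is covered by a positive proportion of the sets, then a few
sets cover almost all points. -/
theorem exists_small_cover {ι G : Type*} [Fintype G] [Nonempty G] [DecidableEq G] (Ω : Finset ι)
    (A : Finset G) (R : ι → G → Prop) [∀ i, DecidablePred (R i)] {η : ℝ} (hη : 0 < η) (hη1 : η ≤ 1)
    (h : ∀ i ∈ Ω, η * Fintype.card G ≤ #{g ∈ A | R i g}) (s : ℕ) :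
    ∃ T ⊆ A, #T ≤ s ∧ (#{i ∈ Ω | ∀ g ∈ T, ¬ R i g} : ℝ) ≤ (1 - η) ^ s * #Ω := by
  classical
  induction s with
  | zero => exact ⟨∅, empty_subset _, by simp, by simp⟩
  | succ s ih =>
    obtain ⟨T, hTA, hTs, hT⟩ := ih
    set Y : Finset ι := {i ∈ Ω | ∀ g ∈ T, ¬ R i g} with hY
    rcases Y.eq_empty_or_nonempty with hY0 | hY0
    · refine ⟨T, hTA, hTs.trans (Nat.le_succ s), ?_⟩
      rw [← hY, hY0]
      have : 0 ≤ 1 - η := by linarith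
      simp only [card_empty, Nat.cast_zero]
      positivity
    have hsum : ∑ i ∈ Y, #{g ∈ A | R i g} = ∑ g ∈ A, #{i ∈ Y | R i g} :=
      sum_card_bipartiteAbove_eq_sum_card_bipartiteBelow R
    have hlow : η * Fintype.card G * #Y ≤ ∑ g ∈ A, (#{i ∈ Y | R i g} : ℝ) := by
      have h1 : ∑ i ∈ Y, η * Fintype.card G ≤ ∑ i ∈ Y, (#{g ∈ A | R i g} : ℝ) :=
        sum_le_sum fun i hi => h i (mem_filter.1 hi).1
      rw [sum_const, nsmul_eq_mul] at h1
      have h2 : ∑ i ∈ Y, (#{g ∈ A | R i g} : ℝ) = ∑ g ∈ A, (#{i ∈ Y | R i g} : ℝ) := by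
        exact_mod_cast hsum
      linarith
    have hYpos : (0 : ℝ) < #Y := by exact_mod_cast card_pos.2 hY0
    have hG : (0 : ℝ) ≤ Fintype.card G := by positivity
    -- Averaging over `A`, which has at most |G| elements: some g covers a proportion η of what is
    -- still uncovered.
    have hex : ∃ g ∈ A, η * #Y ≤ #{i ∈ Y | R i g} := by
      by_contra! hlt
      rcases A.eq_empty_or_nonempty with hA | hA
      · rw [hA, sum_empty] at hlow
        have h3 : 0 < η * Fintype.card G * #Y :=
          mul_pos (mul_pos hη (Nat.cast_pos.2 Fintype.card_pos)) hYpos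
        linarith
      · have h3 := sum_lt_sum_of_nonempty hA hlt
        rw [sum_const, nsmul_eq_mul] at h3
        have h4 : (#A : ℝ) ≤ Fintype.card G := by exact_mod_cast card_le_univ A
        have h5 : (#A : ℝ) * (η * #Y) ≤ Fintype.card G * (η * #Y) := by gcongr
        linarith
    obtain ⟨g, hgA, hg⟩ := hex
    refine ⟨insert g T, insert_subset hgA hTA, (card_insert_le _ _).trans (by omega), ?_⟩
    have hsub : ({i ∈ Ω | ∀ g' ∈ insert g T, ¬ R i g'} : Finset ι) = {i ∈ Y | ¬ R i g} := by
      ext i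
      simp only [hY, mem_filter, mem_insert, forall_eq_or_imp]
      tauto
    have hcard := card_filter_add_card_filter_not (s := Y) (fun i => R i g)
    have hcardR : (#{i ∈ Y | R i g} : ℝ) + #{i ∈ Y | ¬ R i g} = #Y := by exact_mod_cast hcard
    rw [hsub]
    calc (#{i ∈ Y | ¬ R i g} : ℝ) ≤ (1 - η) * #Y := by linarith
      _ ≤ (1 - η) * ((1 - η) ^ s * #Ω) := by
          gcongr
      _ = _ := by ring

end Averaging

/-! ### Few surjections are unbalanced. -/

section Balance

open Finset

section Proportion

variable {F V W U : Type*} [Field F] [AddCommGroup V] [Module F V] [AddCommGroup W] [Module F W]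
  [AddCommGroup U] [Module F U] [Fintype V] [Fintype W] [Fintype U] [DecidableEq W] [DecidableEq U]
  [Fintype (V ≃ₗ[F] V)] [Fintype (V →ₗ[F] U)]

open Classical in
/-- If a proportion `δ` of the surjective maps is unbalanced on `S`, then for a proportion `δ / 4`
of the automorphisms `g` the deviation set of `N ∘ g` is small but nearly contains a fiber of `M`. -/
theorem card_small_deviationSet_ge [FiniteDimensional F V] {N : V →ₗ[F] W} {M : W →ₗ[F] U}
    (hN : Function.Surjective N) (hM : Function.Surjective M) {k : ℕ}
    (hk : k * Fintype.card U = Fintype.card W) (S : Finset V) {τ μ b a δ : ℝ} (hτ : 0 < τ)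
    (hμ : 0 < μ) (hμS : μ * Fintype.card W = #S) (hb : 8 * (1 + τ) ≤ b * μ * τ ^ 2)
    (ha : 16 ≤ δ * (a * (τ ^ 2 * μ))) (hδ : 0 < δ)
    (hbad : δ * #{L : V →ₗ[F] U | Function.Surjective L} ≤ #{L : V →ₗ[F] U |
      Function.Surjective L ∧ ∃ y, τ * (μ * k) < |(#{x ∈ S | L x = y} : ℝ) - μ * k|}) :
    δ / 4 * Fintype.card (V ≃ₗ[F] V) ≤
      #{g ∈ ({g | (#(deviationSet S (fun x => N (g x)) (τ * μ / 2) μ) : ℝ) ≤ a * Fintype.card W} :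
          Finset (V ≃ₗ[F] V)) |
        ∃ y, (#{p | M p = y ∧ p ∉ deviationSet S (fun x => N (g x)) (τ * μ / 2) μ} : ℝ) ≤ b * k} := by
  set Sur : Finset (V →ₗ[F] U) := {L | Function.Surjective L} with hSur
  set Bad : Finset (V →ₗ[F] U) := {L | Function.Surjective L ∧
    ∃ y, τ * (μ * k) < |(#{x ∈ S | L x = y} : ℝ) - μ * k|} with hBad
  set P : Finset (V ≃ₗ[F] V) := {g | ∃ y,
    (#{p | M p = y ∧ p ∉ deviationSet S (fun x => N (g x)) (τ * μ / 2) μ} : ℝ) ≤ b * k} with hP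
  have hL₀ : Function.Surjective (M ∘ₗ N) := hM.comp hN
  have hc : ∀ L ∈ Sur, #((M ∘ₗ N).transporter L) = #((M ∘ₗ N).transporter (M ∘ₗ N)) := fun L hL =>
    LinearMap.card_transporter (mem_filter.1 hL).2 hL₀
  set c := #((M ∘ₗ N).transporter (M ∘ₗ N)) with hcdef
  have hG : Fintype.card (V ≃ₗ[F] V) = #Sur * c := by
    rw [← card_univ, card_eq_sum_card_fiberwise (t := Sur)
      (f := fun g : V ≃ₗ[F] V => (M ∘ₗ N) ∘ₗ g.toLinearMap)]
    · rw [← smul_eq_mul, ← sum_const]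
      exact sum_congr rfl fun L hL => hc L hL
    · intro g _
      simp only [hSur, coe_filter, mem_univ, true_and, Set.mem_ofPred_eq]
      exact hL₀.comp g.surjective
  have hBadSur : Bad ⊆ Sur := fun L hL => by
    simp only [hBad, hSur, mem_filter, mem_univ, true_and] at hL ⊢
    exact hL.1
  -- The automorphisms split into classes of equal size c over the surjections, and each bad L puts
  -- half of its class in `P`. So `P` has proportion at least δ/2, of which the dense deviation sets
  -- remove at most δ/4.
  have hstep : ∀ L ∈ Bad, (c : ℝ) ≤ 2 * #{g ∈ P | (M ∘ₗ N) ∘ₗ g.toLinearMap = L} := by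
    intro L hL
    obtain ⟨hLs, y, hy⟩ := (mem_filter.1 hL).2
    have h1 := card_transporter_le_two_mul hN hM hLs hk S y hτ hμ hb hy
    rw [hc L (hBadSur hL)] at h1
    refine h1.trans ?_
    gcongr
    intro g hg
    rw [mem_filter, LinearMap.mem_transporter] at hg
    rw [mem_filter]
    exact ⟨mem_filter.2 ⟨mem_univ _, y, hg.2⟩, hg.1⟩
  have hPcard : (#Bad : ℝ) * c ≤ 2 * #P := by
    have h1 : ∑ L ∈ Bad, #{g ∈ P | (M ∘ₗ N) ∘ₗ g.toLinearMap = L} ≤ #P :=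
      (sum_card_fiberwise_eq_card_filter _ _ _).trans_le (card_filter_le _ _)
    have h1R : ∑ L ∈ Bad, (#{g ∈ P | (M ∘ₗ N) ∘ₗ g.toLinearMap = L} : ℝ) ≤ #P := by
      exact_mod_cast h1
    calc (#Bad : ℝ) * c = ∑ L ∈ Bad, (c : ℝ) := by rw [sum_const, nsmul_eq_mul]
      _ ≤ ∑ L ∈ Bad, 2 * (#{g ∈ P | (M ∘ₗ N) ∘ₗ g.toLinearMap = L} : ℝ) := sum_le_sum hstep
      _ ≤ 2 * #P := by rw [← mul_sum]; linarith
  have hδG : δ * Fintype.card (V ≃ₗ[F] V) ≤ 2 * #P := by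
    rw [hG]
    push_cast
    calc δ * (#Sur * c) = δ * #Sur * c := by ring
      _ ≤ #Bad * c := by gcongr
      _ ≤ _ := hPcard
  set H : Finset (V ≃ₗ[F] V) :=
    {g | a * Fintype.card W < #(deviationSet S (fun x => N (g x)) (τ * μ / 2) μ)} with hH
  have hHcard : (#H : ℝ) ≤ δ / 4 * Fintype.card (V ≃ₗ[F] V) := by
    have h1 := card_dense_deviationSet_mul_le hN S (ρ := τ * μ / 2) (a := a) (by positivity) hμS
    rw [← hH] at h1
    have h2 : (4 : ℝ) / δ * μ ≤ a * (τ * μ / 2) ^ 2 := by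
      rw [div_mul_eq_mul_div, div_le_iff₀ hδ]
      nlinarith
    have h3 : (#H : ℝ) * (4 / δ * μ) ≤ Fintype.card (V ≃ₗ[F] V) * μ :=
      (mul_le_mul_of_nonneg_left h2 (Nat.cast_nonneg _)).trans h1
    have h4 : (#H : ℝ) * (4 / δ) ≤ Fintype.card (V ≃ₗ[F] V) := by
      refine le_of_mul_le_mul_right ?_ hμ
      linarith
    rw [mul_div_assoc', div_le_iff₀ hδ] at h4
    linarith
  have hcover : P ⊆ ({g ∈ ({g | (#(deviationSet S (fun x => N (g x)) (τ * μ / 2) μ) : ℝ) ≤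
      a * Fintype.card W} : Finset (V ≃ₗ[F] V)) |
        ∃ y, (#{p | M p = y ∧ p ∉ deviationSet S (fun x => N (g x)) (τ * μ / 2) μ} : ℝ) ≤ b * k}) ∪
      H := by
    intro g hg
    rw [mem_union, mem_filter, mem_filter, hH, mem_filter]
    rcases le_or_gt (#(deviationSet S (fun x => N (g x)) (τ * μ / 2) μ) : ℝ)
      (a * Fintype.card W) with h | h
    · exact Or.inl ⟨⟨mem_univ _, h⟩, (mem_filter.1 hg).2⟩
    · exact Or.inr ⟨mem_univ _, h⟩
  have hfin : (#P : ℝ) ≤ (#{g ∈ ({g | (#(deviationSet S (fun x => N (g x)) (τ * μ / 2) μ) : ℝ) ≤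
      a * Fintype.card W} : Finset (V ≃ₗ[F] V)) |
        ∃ y, (#{p | M p = y ∧ p ∉ deviationSet S (fun x => N (g x)) (τ * μ / 2) μ} : ℝ) ≤ b * k} : ℝ)
      + #H := by
    exact_mod_cast (card_le_card hcover).trans (card_union_le _ _)
  linarith

end Proportion

theorem LinearMap.exists_surjective_ker_eq_span {F : Type*} [Field F] {m t k : ℕ} (htm : t + k = m)
    {v : Fin k → Fin m → F} (hv : LinearIndependent F v) :
    ∃ M : (Fin m → F) →ₗ[F] (Fin t → F), Function.Surjective M ∧
      LinearMap.ker M = Submodule.span F (Set.range v) := by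
  have hrank : Module.finrank F ((Fin m → F) ⧸ Submodule.span F (Set.range v)) =
      Module.finrank F (Fin t → F) := by
    have h1 := Submodule.finrank_quotient_add_finrank (Submodule.span F (Set.range v))
    rw [finrank_span_eq_card hv] at h1
    simp only [Module.finrank_fintype_fun_eq_card, Fintype.card_fin] at h1 ⊢
    omega
  let e := LinearEquiv.ofFinrankEq _ _ hrank
  refine ⟨e.toLinearMap ∘ₗ Submodule.mkQ _, ?_, ?_⟩
  · exact e.surjective.comp (Submodule.mkQ_surjective _)
  · rw [LinearEquiv.ker_comp, Submodule.ker_mkQ]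

theorem LinearMap.exists_surjective_pi {F : Type*} [Field F] {m n : ℕ} (h : m ≤ n) :
    ∃ N : (Fin n → F) →ₗ[F] (Fin m → F), Function.Surjective N :=
  ⟨LinearMap.funLeft F F (Fin.castLE h),
    LinearMap.funLeft_surjective_of_injective F F _ (Fin.castLE_injective h)⟩

/-- Dependent pairs are negligible: x ≥ (159/160)² q^(2m), and 2 · 0.63 · (159/160)² > 1. -/
theorem two_mul_card_ge_of_card_ge {q m : ℕ} (hq : 160 ≤ q) (hm : 2 ≤ m) {x y : ℕ}
    (hx : x = (q ^ m - 1) * (q ^ m - q)) (hy : (0.63 : ℝ) * x ≤ y) : q ^ (2 * m) ≤ 2 * y := by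
  have h1 : 160 * q ≤ q ^ m := by
    calc 160 * q ≤ q * q := Nat.mul_le_mul_right _ hq
      _ = q ^ 2 := (sq q).symm
      _ ≤ q ^ m := Nat.pow_le_pow_right (by omega) hm
  have h2 : (x : ℝ) = ((q : ℝ) ^ m - 1) * ((q : ℝ) ^ m - q) := by
    rw [hx]
    push_cast [Nat.cast_sub (show 1 ≤ q ^ m by omega), Nat.cast_sub (show q ≤ q ^ m by omega)]
    rfl
  have h3 : (160 : ℝ) * q ≤ (q : ℝ) ^ m := by exact_mod_cast h1
  have h4 : (160 : ℝ) ≤ q := by exact_mod_cast hq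
  have h5 : ((q : ℝ) ^ m) ^ 2 ≤ 2 * y := by
    set z := (q : ℝ) ^ m
    have h6 : 159 / 160 * z ≤ z - 1 := by linarith
    have h7 : 159 / 160 * z ≤ z - q := by linarith
    have hz : 0 ≤ 159 / 160 * z := by linarith
    have h8 : (159 / 160 * z) * (159 / 160 * z) ≤ (z - 1) * (z - q) :=
      mul_le_mul h6 h7 hz (hz.trans h6)
    nlinarith
  rw [mul_comm, pow_mul]
  exact_mod_cast h5

open Classical in
/-- Few surjective linear maps are unbalanced on a large set. -/
theorem card_unbalanced_le {F : Type*} [Field F] [Fintype F] {n m t : ℕ}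
    [Fintype ((Fin n → F) →ₗ[F] (Fin t → F))] (hn : 5 ≤ n) (htm : t + 2 = m) (hm : m ≤ n)
    (hq : 32 * n ≤ Fintype.card F) (S : Finset (Fin n → F)) (hS : Fintype.card F ^ (m + 1) < #S)
    {τ δ : ℝ} (hτ : 0 < τ) (hδ : 0 < δ) (hδ1 : δ < 1)
    (hqτ : 32 * (n * (1 + τ)) ≤ Fintype.card F * (τ * δ) ^ 2) :
    (#{L : (Fin n → F) →ₗ[F] (Fin t → F) | Function.Surjective L ∧ ∃ y,
      τ * (#S / (Fintype.card F : ℝ) ^ t) <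
        |(#{x ∈ S | L x = y} : ℝ) - #S / (Fintype.card F : ℝ) ^ t|} : ℝ) ≤
      δ * #{L : (Fin n → F) →ₗ[F] (Fin t → F) | Function.Surjective L} := by
  by_contra! hcon
  set q := Fintype.card F with hqdef
  have hq0 : (0 : ℝ) < q := by
    have : 0 < q := by omega
    exact_mod_cast this
  have hn0 : (0 : ℝ) < n := by
    have : 0 < n := by omega
    exact_mod_cast this
  have : Finite ((Fin n → F) ≃ₗ[F] (Fin n → F)) := DFunLike.finite _
  let _ : Fintype ((Fin n → F) ≃ₗ[F] (Fin n → F)) := Fintype.ofFinite _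
  have hcardW : Fintype.card (Fin m → F) = q ^ m := by simp [hqdef]
  have hcardU : Fintype.card (Fin t → F) = q ^ t := by simp [hqdef]
  have hk : q ^ 2 * Fintype.card (Fin t → F) = Fintype.card (Fin m → F) := by
    rw [hcardW, hcardU, ← htm, pow_add, mul_comm]
  set μ : ℝ := #S / (q : ℝ) ^ m with hμdef
  have hμS : μ * Fintype.card (Fin m → F) = #S := by
    rw [hcardW, hμdef]
    push_cast
    field_simp
  -- The factor q by which |S| exceeds q^m makes the mean fiber large, so the lower bound on qτ²δ²
  -- passes to μτ²δ².
  have hμq : q < μ := by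
    rw [hμdef, lt_div_iff₀ (by positivity), ← pow_succ']
    exact_mod_cast hS
  have hμ0 : 0 < μ := hq0.trans hμq
  have hμk : μ * ((q ^ 2 : ℕ) : ℝ) = #S / (q : ℝ) ^ t := by
    rw [hμdef, ← htm, pow_add]
    push_cast
    field_simp
  -- b is the missing fraction of a plane tolerated by the polynomial method, as m ≤ n. The density
  -- a lets about 4/δ deviation sets fit in half of the space. The constant 32 is both 8 · 4, for b,
  -- and 16 · 2, for a.
  set b : ℝ := 1 / (4 * n) with hbdef
  set a : ℝ := δ / (2 * n) with hadef
  have hτμ : 32 * (n * (1 + τ)) ≤ μ * (τ ^ 2 * δ ^ 2) := by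
    calc 32 * (n * (1 + τ)) ≤ q * (τ * δ) ^ 2 := hqτ
      _ ≤ μ * (τ * δ) ^ 2 := by gcongr
      _ = _ := by ring
  have hb : 8 * (1 + τ) ≤ b * μ * τ ^ 2 := by
    rw [hbdef, show 1 / (4 * (n : ℝ)) * μ * τ ^ 2 = μ * τ ^ 2 / (4 * n) by ring,
      le_div_iff₀ (by positivity)]
    have h1 : μ * (τ ^ 2 * δ ^ 2) ≤ μ * τ ^ 2 := by
      have : δ ^ 2 ≤ 1 := pow_le_one₀ hδ.le hδ1.le
      calc μ * (τ ^ 2 * δ ^ 2) ≤ μ * (τ ^ 2 * 1) := by gcongr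
        _ = _ := by ring
    linarith
  have ha : 16 ≤ δ * (a * (τ ^ 2 * μ)) := by
    rw [hadef, show δ * (δ / (2 * (n : ℝ)) * (τ ^ 2 * μ)) = μ * (τ ^ 2 * δ ^ 2) / (2 * n) by ring,
      le_div_iff₀ (by positivity)]
    have : (0 : ℝ) < n * τ := by positivity
    linarith
  obtain ⟨N, hN⟩ := LinearMap.exists_surjective_pi (F := F) hm
  -- M is adapted to v so that its fibers are the translates of the plane spanned by v.
  have hMex : ∀ v : Fin 2 → Fin m → F, ∃ M : (Fin m → F) →ₗ[F] (Fin t → F),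
      LinearIndependent F v → Function.Surjective M ∧
        LinearMap.ker M = Submodule.span F (Set.range v) := by
    intro v
    by_cases hv : LinearIndependent F v
    · obtain ⟨M, hM⟩ := LinearMap.exists_surjective_ker_eq_span htm hv
      exact ⟨M, fun _ => hM⟩
    · exact ⟨0, fun h => absurd h hv⟩
  choose M hM using hMex
  let E : ((Fin n → F) ≃ₗ[F] (Fin n → F)) → Finset (Fin m → F) := fun g =>
    deviationSet S (fun x => N (g x)) (τ * μ / 2) μ
  let R : (Fin 2 → Fin m → F) → ((Fin n → F) ≃ₗ[F] (Fin n → F)) → Prop := fun v g =>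
    ∃ y, (#{p | M v p = y ∧ p ∉ E g} : ℝ) ≤ b * (q ^ 2 : ℕ)
  let A : Finset ((Fin n → F) ≃ₗ[F] (Fin n → F)) :=
    {g | (#(E g) : ℝ) ≤ a * Fintype.card (Fin m → F)}
  let Ω : Finset (Fin 2 → Fin m → F) := {v | LinearIndependent F v}
  have hprop : ∀ v ∈ Ω, δ / 4 * Fintype.card ((Fin n → F) ≃ₗ[F] (Fin n → F)) ≤
      #{g ∈ A | R v g} := by
    intro v hv
    obtain ⟨hMs, -⟩ := hM v (mem_filter.1 hv).2
    exact card_small_deviationSet_ge hN hMs hk S hτ hμ0 hμS hb ha hδ (by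
      simp only [hμk]
      exact hcon.le)
  obtain ⟨T, hTA, hTs, hT⟩ := exists_small_cover Ω A R (η := δ / 4) (by positivity) (by linarith)
    hprop ⌈4 / δ⌉₊
  set s := ⌈4 / δ⌉₊ with hs
  have hs1 : 4 / δ ≤ s := Nat.le_ceil _
  have hs2 : (s : ℝ) < 4 / δ + 1 := Nat.ceil_lt_add_one (by positivity)
  -- As sδ/4 ≥ 1, the uncovered proportion is at most 1/e < 0.37.
  have hexp : (1 - δ / 4) ^ s ≤ (0.37 : ℝ) := by
    have h1 : (1 - δ / 4 : ℝ) ≤ Real.exp (-(δ / 4)) := by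
      have := Real.add_one_le_exp (-(δ / 4))
      linarith
    have h2 : (1 - δ / 4 : ℝ) ^ s ≤ Real.exp (-(δ / 4)) ^ s :=
      pow_le_pow_left₀ (by linarith) h1 s
    rw [← Real.exp_nat_mul] at h2
    have h3 : (s : ℝ) * (-(δ / 4)) ≤ -1 := by
      rw [div_le_iff₀ hδ] at hs1
      linarith
    refine h2.trans ((Real.exp_le_exp.2 h3).trans ?_)
    rw [Real.exp_neg, inv_le_comm₀ (Real.exp_pos _) (by norm_num)]
    have := Real.exp_one_gt_d9
    norm_num at this ⊢
    linarith
  set Ω' : Finset (Fin 2 → Fin m → F) := {v ∈ Ω | ¬ ∀ g ∈ T, ¬ R v g} with hΩ'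
  have hΩsplit := card_filter_add_card_filter_not (s := Ω) (fun v => ∀ g ∈ T, ¬ R v g)
  have hΩsplitR : (#{v ∈ Ω | ∀ g ∈ T, ¬ R v g} : ℝ) + #Ω' = #Ω := by exact_mod_cast hΩsplit
  have hΩ'card : (0.63 : ℝ) * #Ω ≤ #Ω' := by
    have : (1 - δ / 4) ^ s * (#Ω : ℝ) ≤ 0.37 * #Ω := by gcongr
    linarith
  have hΩcard : #Ω = (q ^ m - 1) * (q ^ m - q) := by
    have h1 := card_linearIndependent (K := F) (V := Fin m → F) (k := 2)
      (by rw [Module.finrank_fintype_fun_eq_card, Fintype.card_fin]; omega)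
    rw [Nat.card_eq_fintype_card, Fintype.card_subtype, Fin.prod_univ_two,
      Module.finrank_fintype_fun_eq_card, Fintype.card_fin] at h1
    simpa [Ω, hqdef] using h1
  set E' : Finset (Fin m → F) := T.biUnion E with hE'
  have hE'card : 2 * #E' ≤ q ^ m := by
    have h1 : (#E' : ℝ) ≤ ∑ g ∈ T, (#(E g) : ℝ) := by exact_mod_cast card_biUnion_le
    have h2 : ∑ g ∈ T, (#(E g) : ℝ) ≤ ∑ g ∈ T, a * (q : ℝ) ^ m := by
      refine sum_le_sum fun g hg => ?_
      have h := (mem_filter.1 (hTA hg)).2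
      rw [hcardW] at h
      exact_mod_cast h
    rw [sum_const, nsmul_eq_mul] at h2
    have h3 : (#T : ℝ) ≤ s := by exact_mod_cast hTs
    have h4 : (#T : ℝ) * a ≤ 1 / 2 := by
      have h5 : (#T : ℝ) ≤ 4 / δ + 1 := by linarith
      calc (#T : ℝ) * a ≤ (4 / δ + 1) * (δ / (2 * n)) := by
            rw [hadef]; gcongr
        _ = (4 + δ) / (2 * n) := by field_simp
        -- This needs 4 + δ ≤ n, which is where n ≥ 5 and δ < 1 enter.
        _ ≤ 1 / 2 := by
            rw [div_le_iff₀ (by positivity)]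
            have : (5 : ℝ) ≤ n := by exact_mod_cast hn
            linarith
    have h6 : (#T : ℝ) * (a * (q : ℝ) ^ m) ≤ 1 / 2 * (q : ℝ) ^ m := by
      rw [← mul_assoc]; gcongr
    have h7 : 2 * (#E' : ℝ) ≤ (q : ℝ) ^ m := by linarith
    exact_mod_cast h7
  refine MvPolynomial.false_of_planes (m := m) (by omega) (by omega) E' hE'card Ω'
    (two_mul_card_ge_of_card_ge (by omega) (by omega) hΩcard hΩ'card) ?_
  intro v hv
  obtain ⟨hvΩ, hvT⟩ := mem_filter.1 hv
  push Not at hvT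
  obtain ⟨g, hgT, y, hy⟩ := hvT
  obtain ⟨hMs, hMker⟩ := hM v (mem_filter.1 hvΩ).2
  obtain ⟨x₀, hx₀⟩ := hMs y
  refine ⟨x₀, ?_⟩
  have hfib : #{p | M v p = y} = q ^ 2 := by
    have h := LinearMap.card_fiber_mul_card hMs y
    rw [← hk] at h
    exact Nat.eq_of_mul_eq_mul_right (Fintype.card_pos_iff.2 ⟨0⟩) h
  have hsplit := card_filter_add_card_filter_not (s := ({p | M v p = y} : Finset (Fin m → F)))
    (fun p => p ∈ E g)
  rw [hfib, filter_filter, filter_filter] at hsplit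
  have hle : #{p | M v p = y ∧ p ∈ E g} ≤ #{s : Fin 2 → F | x₀ + ∑ i, s i • v i ∈ E'} := by
    refine card_le_card_of_surjOn (fun s : Fin 2 → F => x₀ + ∑ i, s i • v i) ?_
    intro p hp
    obtain ⟨hp1, hp2⟩ := (mem_filter.1 (mem_coe.1 hp)).2
    have hker : p - x₀ ∈ LinearMap.ker (M v) := by
      rw [LinearMap.mem_ker, map_sub, hp1, hx₀, sub_self]
    rw [hMker, Submodule.mem_span_range_iff_exists_fun] at hker
    obtain ⟨s, hs⟩ := hker
    have hps : x₀ + ∑ i, s i • v i = p := by rw [hs]; abel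
    refine ⟨s, ?_, hps⟩
    rw [mem_coe, mem_filter]
    exact ⟨mem_univ _, by rw [hps]; exact mem_biUnion.2 ⟨g, hgT, hp2⟩⟩
  have hbm : 4 * (m : ℝ) * (b * (q ^ 2 : ℕ)) ≤ (q ^ 2 : ℕ) := by
    have h1 : 4 * (m : ℝ) * b ≤ 1 := by
      rw [hbdef, mul_one_div, div_le_one (by positivity)]
      have : (m : ℝ) ≤ n := by exact_mod_cast hm
      linarith
    calc 4 * (m : ℝ) * (b * (q ^ 2 : ℕ)) = 4 * (m : ℝ) * b * (q ^ 2 : ℕ) := by ring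
      _ ≤ 1 * (q ^ 2 : ℕ) := by gcongr
      _ = _ := one_mul _
  have hfew : 4 * m * #{p | M v p = y ∧ p ∉ E g} ≤ q ^ 2 := by
    have h1 : 4 * (m : ℝ) * #{p | M v p = y ∧ p ∉ E g} ≤ (q ^ 2 : ℕ) :=
      (mul_le_mul_of_nonneg_left hy (by positivity)).trans hbm
    exact_mod_cast h1
  have h2 := Nat.mul_le_mul_left (4 * m) hle
  rw [← hsplit, mul_add]
  rw [hsplit]
  omega

end Balance

/-! ### From fiber sizes to probabilities. -/

open Finset in
theorem hashDistribution_apply_toReal {F : Type*} [Field F] [Fintype F] [DecidableEq F] {n t : ℕ}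
    (L : (Fin n → F) →ₗ[F] (Fin t → F)) (S : Finset (Fin n → F)) (hS : S.Nonempty)
    (y : Fin t → F) :
    (hashDistribution L S hS y).toReal = #{x ∈ S | L x = y} / #S := by
  classical
  have key : hashDistribution L S hS y = #{x ∈ S | L x = y} * (#S : ENNReal)⁻¹ := by
    rw [hashDistribution, PMF.map_apply, tsum_fintype]
    simp only [PMF.uniformOfFinset_apply]
    trans ∑ x, if x ∈ ({x ∈ S | L x = y} : Finset _) then (#S : ENNReal)⁻¹ else 0
    · refine Finset.sum_congr rfl fun x _ => ?_
      by_cases h : y = L x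
      · simp [h]
      · simp [h, Ne.symm h]
    · rw [← sum_filter, filter_univ_mem, sum_const, nsmul_eq_mul]
  rw [key]
  simp [div_eq_mul_inv]

theorem isLInftyClose_hashDistribution_iff {F : Type*} [Field F] [Fintype F] [DecidableEq F]
    {n t : ℕ} (L : (Fin n → F) →ₗ[F] (Fin t → F)) (S : Finset (Fin n → F)) (hS : S.Nonempty)
    (τ : ℝ) :
    IsLInftyClose (hashDistribution L S hS) (PMF.uniformOfFintype (Fin t → F))
        (τ / (Fintype.card F : ℝ) ^ t) ↔
      ∀ y, |(({x ∈ S | L x = y} : Finset _).card : ℝ) - S.card / (Fintype.card F : ℝ) ^ t| ≤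
        τ * (S.card / (Fintype.card F : ℝ) ^ t) := by
  have hS0 : (0 : ℝ) < S.card := by exact_mod_cast hS.card_pos
  refine forall_congr' fun y => ?_
  rw [hashDistribution_apply_toReal, PMF.uniformOfFintype_apply]
  have h1 : (((Fintype.card (Fin t → F) : ENNReal))⁻¹).toReal =
      1 / (Fintype.card F : ℝ) ^ t := by simp
  rw [h1, ← mul_le_mul_iff_right₀ hS0]
  have h2 : ∀ z : ℝ, (S.card : ℝ) * |z| = |S.card * z| := fun z => by
    rw [abs_mul, abs_of_pos hS0]
  rw [h2, mul_sub, mul_div_cancel₀ _ hS0.ne', mul_one_div]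
  rw [show (S.card : ℝ) * (τ / (Fintype.card F : ℝ) ^ t) =
    τ * (S.card / (Fintype.card F : ℝ) ^ t) by ring]

theorem mainTheorem1 {F : Type*} [Field F] [Fintype F] (q : ℕ) (hFq : Fintype.card F = q)
    (n : ℕ) (hn : 5 ≤ n) (S : Finset (Fin n → F)) (hS : S.Nonempty)
    (τ δ : ℝ) (hτ : 0 < τ) (hδ₀ : 0 < δ) (hδ₁ : δ < 1)
    (hq : 32 * max ((n : ℝ) * (1 + τ) / (τ * δ) ^ 2) (n : ℝ) ≤ (q : ℝ))
    (r : ℕ) (hr₁ : 4 ≤ r) (hr₂ : r ≤ n - 1)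
    (hS₁ : q ^ r < S.card) (hS₂ : S.card ≤ q ^ (r + 1))
    (t : ℕ) (ht : t = r - 3) :
    1 - δ ≤ fractionIn (surjLinearMaps F n t)
      {L | IsLInftyClose (hashDistribution L S hS) (PMF.uniformOfFintype (Fin t → F))
        (τ / (q : ℝ) ^ t)} := by
  classical
  subst hFq
  have : Finite ((Fin n → F) →ₗ[F] (Fin t → F)) := DFunLike.finite _
  let _ : Fintype ((Fin n → F) →ₗ[F] (Fin t → F)) := Fintype.ofFinite _
  have hq1 : 32 * n ≤ Fintype.card F := by
    have : (32 : ℝ) * n ≤ Fintype.card F :=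
      (mul_le_mul_of_nonneg_left (le_max_right _ _) (by norm_num)).trans hq
    exact_mod_cast this
  have hq2 : 32 * (n * (1 + τ)) ≤ Fintype.card F * (τ * δ) ^ 2 := by
    have h := (mul_le_mul_of_nonneg_left (le_max_left ((n : ℝ) * (1 + τ) / (τ * δ) ^ 2) (n : ℝ))
      (by norm_num : (0 : ℝ) ≤ 32)).trans hq
    rwa [mul_div_assoc', div_le_iff₀ (by positivity)] at h
  -- m = r − 1 makes the kernels of maps F^m → F^t planes, since t = r − 3, and turns |S| > q^r into
  -- |S| > q^(m+1).
  have hcard := card_unbalanced_le (n := n) (m := r - 1) (t := t) hn (by omega) (by omega) hq1 S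
    (by rwa [show r - 1 + 1 = r by omega]) hτ hδ₀ hδ₁ hq2
  set Sur : Finset ((Fin n → F) →ₗ[F] (Fin t → F)) := {L | Function.Surjective L} with hSur
  obtain ⟨L₀, hL₀⟩ := LinearMap.exists_surjective_pi (F := F) (show t ≤ n by omega)
  have hSur0 : (0 : ℝ) < Sur.card := by
    exact_mod_cast Finset.card_pos.2 ⟨L₀, by simpa [hSur] using hL₀⟩
  have hA : surjLinearMaps F n t = (Sur : Set _) := by
    ext L
    simp [surjLinearMaps, hSur]
  have hAB : surjLinearMaps F n t ∩ {L | IsLInftyClose (hashDistribution L S hS)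
      (PMF.uniformOfFintype (Fin t → F)) (τ / (Fintype.card F : ℝ) ^ t)} =
      ((Sur.filter fun L => ∀ y, |(({x ∈ S | L x = y} : Finset _).card : ℝ) -
        S.card / (Fintype.card F : ℝ) ^ t| ≤ τ * (S.card / (Fintype.card F : ℝ) ^ t) :
          Finset _) : Set _) := by
    ext L
    rw [hA, Set.mem_inter_iff, Finset.mem_coe, Finset.coe_filter]
    exact and_congr_right fun _ => isLInftyClose_hashDistribution_iff L S hS τ
  rw [fractionIn, hAB, hA, Set.ncard_coe_finset, Set.ncard_coe_finset, le_div_iff₀ hSur0]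
  have hsplit := Finset.card_filter_add_card_filter_not (s := Sur) (fun L => ∀ y,
    |(({x ∈ S | L x = y} : Finset _).card : ℝ) - S.card / (Fintype.card F : ℝ) ^ t| ≤
      τ * (S.card / (Fintype.card F : ℝ) ^ t))
  have hbad : (Sur.filter fun L => ¬ ∀ y, |(({x ∈ S | L x = y} : Finset _).card : ℝ) -
      S.card / (Fintype.card F : ℝ) ^ t| ≤ τ * (S.card / (Fintype.card F : ℝ) ^ t)).card =
      ({L | Function.Surjective L ∧ ∃ y, τ * (S.card / (Fintype.card F : ℝ) ^ t) <
        |(({x ∈ S | L x = y} : Finset _).card : ℝ) - S.card / (Fintype.card F : ℝ) ^ t|} :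
          Finset ((Fin n → F) →ₗ[F] (Fin t → F))).card := by
    congr 1
    ext L
    simp [hSur]
  rw [hbad] at hsplit
  have hsplitR := congrArg (Nat.cast (R := ℝ)) hsplit
  push_cast at hsplitR
  linarith
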